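/- Let $\mathbb K$ be $\mathbb R$ or $\mathbb C$ ("holomorphic" means $\mathbb K$-analytic), $1\le q\le n$, $1\le k\le n$, $m$ a natural number, and let $\Omega\subseteq\mathbb K^n$ be a domain. Let $G_q$ be a $q$-parameter abelian (local) Lie group of holomorphic transformations of $\Omega$, $(\alpha,x)\mapsto \Phi_\alpha(x)$, written in canonical parameters $\alpha\in\mathbb K^q$ (so $\Phi_\alpha\circ\Phi_\beta=\Phi_{\alpha+\beta}$), whose infinitesimal operators are $(n-k)$-cylindrical, $$\mathfrak G_l=\sum_{i=1}^n g_{li}(x_1,\dots,x_k)\,\partial_{x_i},\qquad l=1,\dots,q,$$ and are not holomorphically linearly bound on $\Omega$ (there is no nontrivial linear relation between them with holomorphic coefficients). Let $I=(I_1,\dots,I_{n-q})$ be holomorphic absolute invariants of $G_q$ on $\Omega$ that are functionally independent (their differentials are linearly independent on a dense subset of $\Omega$). A system $dx=f(x)\,dt$, $t\in\mathbb K^m$, with a holomorphic $n\times m$ matrix $f$ on a domain $U$, is completely solvable on $U$ if every Cauchy problem $x(t_0)=x_0\in U$ has a local solution. It admits $G_q$ if the transformations of $G_q$ take its solutions to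 solutions, as long as they move them inside $U$ (that is, along the whole arc $\Phi_{s\alpha}$, $0\le s\le1$); invariants on $U$ are understood in the same way. The invariants $I$ are a basis on $U$ (a universal invariant) if they are functionally independent on $U$ and every holomorphic absolute invariant on $U$ is a holomorphic function of $I$. (a) Let $U\subseteq\Omega$ be any domain (for instance $U=\Omega$) and let $$\mathfrak G_\tau=\sum_{i=1}^n g_{\tau i}(x)\,\partial_{x_i},\qquad \tau=q+1,\dots,n,$$ be any operators with holomorphic coordinates on $U$ that commute with each other and with $\mathfrak G_1,\dots,\mathfrak G_q$ and are such that $\mathfrak G_1,\dots,\mathfrak G_n$ are not holomorphically linearly bound on $U$. Consider, for a completely solvable system $dx=f(x)\,dt$ on $U$, the representation $$dx_i=\sum_{j=1}^m\Bigl(\sum_{l=1}^q\varphi_{jl}(I(x))\,g_{li}(x_1,\dots,x_k)+\sum_{\tau=q+1}^n\varphi_{j\tau}(I(x))\,g_{\tau i}(x)\Bigr)dt_j,\qquad i=1,\dots,n,\qquad(*)$$ on $U$, with functions $\varphi_{ji}$ holomorphic on a domain $W\subseteq\mathbb K^{n-q}$ that contains $I(U)$. If the system has the form $(*)$, then it admits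 $G_q$. If moreover $I$ is a basis of absolute invariants on $U$ and $\mathfrak G_1,\dots,\mathfrak G_n$ are a basis at every point of $U$, then the system admits $G_q$ if and only if it has the form $(*)$. (b) The points $p\in\Omega$ at which $\mathfrak G_1,\dots,\mathfrak G_q$ are linearly independent and $dI_1,\dots,dI_{n-q}$ are linearly independent are dense in $\Omega$, and every such $p$ has arbitrarily small connected open neighbourhoods $U\subseteq\Omega$ on which $I$ is a basis of absolute invariants and on which there is an $(n-q)$-parameter abelian Lie group $\widetilde G_{n-q}$ whose infinitesimal operators $\mathfrak G_{q+1},\dots,\mathfrak G_n$ commute with $\mathfrak G_1,\dots,\mathfrak G_q$ and form with them a basis at every point of $U$. -/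

import Mathlib

open scoped Topology

/-- A `q`-parameter abelian (local) Lie group of transformations of a set `Ω ⊆ 𝕜ⁿ`, written in
canonical parameters `α ∈ 𝕜^q`, for which the group law is addition and the identity is `α = 0`
(a connected abelian Lie group is a quotient of its additive universal covering group `𝕜^q`).
`act α x` is meaningful for `(α, x) ∈ dom`, where `dom` is an open neighbourhood of `{0} × Ω`;
the group laws hold wherever both sides are defined. -/
structure LocalAbelianGroup (𝕜 : Type*) [RCLike 𝕜] (q n : ℕ) (Ω : Set (Fin n → 𝕜)) where
  dom : Set ((Fin q → 𝕜) × (Fin n → 𝕜))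
  act : (Fin q → 𝕜) → (Fin n → 𝕜) → (Fin n → 𝕜)
  isOpen_dom : IsOpen dom
  snd_mem : ∀ α x, (α, x) ∈ dom → x ∈ Ω
  zero_mem : ∀ x ∈ Ω, ((0 : Fin q → 𝕜), x) ∈ dom
  act_mem : ∀ α x, (α, x) ∈ dom → act α x ∈ Ω
  analytic_act : AnalyticOnNhd 𝕜 (fun p : (Fin q → 𝕜) × (Fin n → 𝕜) => act p.1 p.2) dom
  act_zero : ∀ x ∈ Ω, act 0 x = x
  act_add : ∀ α β x, (β, x) ∈ dom → (α, act β x) ∈ dom → (α + β, x) ∈ dom →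
    act α (act β x) = act (α + β) x
  neg_mem : ∀ α x, (α, x) ∈ dom → (-α, act α x) ∈ dom

/-- The `l`-th infinitesimal operator of the group, as a vector field: `∂/∂α_l` of the action
at `α = 0`. -/
noncomputable def LocalAbelianGroup.infOp {𝕜 : Type*} [RCLike 𝕜] {q n : ℕ}
    {Ω : Set (Fin n → 𝕜)} (G : LocalAbelianGroup 𝕜 q n Ω) (l : Fin q) (x : Fin n → 𝕜) :
    Fin n → 𝕜 :=
  fderiv 𝕜 (fun α => G.act α x) 0 (Pi.single l 1)

/-- The transformation with parameter `α` moves the point `x` inside `U`: the whole arc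
`s ↦ act (s α) x`, `0 ≤ s ≤ 1`, is defined and lies in `U`. -/
def LocalAbelianGroup.MovesIn {𝕜 : Type*} [RCLike 𝕜] {q n : ℕ} {Ω : Set (Fin n → 𝕜)}
    (G : LocalAbelianGroup 𝕜 q n Ω) (U : Set (Fin n → 𝕜)) (α : Fin q → 𝕜) (x : Fin n → 𝕜) : Prop :=
  ∀ s : ℝ, 0 ≤ s → s ≤ 1 → ((s : 𝕜) • α, x) ∈ G.dom ∧ G.act ((s : 𝕜) • α) x ∈ U

/-- `u` is an absolute invariant of the group on `U`. -/
def LocalAbelianGroup.IsInvariant {𝕜 : Type*} [RCLike 𝕜] {q n : ℕ} {Ω : Set (Fin n → 𝕜)}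
    (G : LocalAbelianGroup 𝕜 q n Ω) (U : Set (Fin n → 𝕜)) (u : (Fin n → 𝕜) → 𝕜) : Prop :=
  ∀ α x, x ∈ U → G.MovesIn U α x → u (G.act α x) = u x

/-- The components of `I` are functionally independent on `U`: their differentials are linearly
independent at the points of a dense subset of `U`. -/
def FunctionallyIndependent {𝕜 : Type*} [RCLike 𝕜] {n r : ℕ} (U : Set (Fin n → 𝕜))
    (I : (Fin n → 𝕜) → (Fin r → 𝕜)) : Prop :=
  U ⊆ closure {x ∈ U | LinearIndependent 𝕜 (fun τ : Fin r => fderiv 𝕜 (fun y => I y τ) x)}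

/-- `I` consists of `n - q` holomorphic, functionally independent absolute invariants on `U`. -/
def LocalAbelianGroup.IndependentInvariants {𝕜 : Type*} [RCLike 𝕜] {q n : ℕ}
    {Ω : Set (Fin n → 𝕜)} (G : LocalAbelianGroup 𝕜 q n Ω) (U : Set (Fin n → 𝕜))
    (I : (Fin n → 𝕜) → (Fin (n - q) → 𝕜)) : Prop :=
  AnalyticOnNhd 𝕜 I U ∧ (∀ τ, G.IsInvariant U (fun x => I x τ)) ∧ FunctionallyIndependent U I

/-- `I` is a basis of absolute invariants (a universal invariant) on `U`: in addition, every
holomorphic absolute invariant on `U` is a holomorphic function of `I`. -/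
def LocalAbelianGroup.IsInvariantBasis {𝕜 : Type*} [RCLike 𝕜] {q n : ℕ}
    {Ω : Set (Fin n → 𝕜)} (G : LocalAbelianGroup 𝕜 q n Ω) (U : Set (Fin n → 𝕜))
    (I : (Fin n → 𝕜) → (Fin (n - q) → 𝕜)) : Prop :=
  G.IndependentInvariants U I ∧
    ∀ u : (Fin n → 𝕜) → 𝕜, AnalyticOnNhd 𝕜 u U → G.IsInvariant U u →
      ∃ φ : (Fin (n - q) → 𝕜) → 𝕜, AnalyticOnNhd 𝕜 φ (I '' U) ∧ ∀ x ∈ U, u x = φ (I x)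

/-- The operators `∑ᵢ (v a x)ᵢ ∂ᵢ` are not holomorphically linearly bound on `U`: there is no
nontrivial linear relation between them with holomorphic coefficients. -/
def NotHolLinearlyBound {𝕜 : Type*} [RCLike 𝕜] {n : ℕ} {ι : Type*} [Fintype ι]
    (U : Set (Fin n → 𝕜)) (v : ι → (Fin n → 𝕜) → (Fin n → 𝕜)) : Prop :=
  ∀ a : ι → (Fin n → 𝕜) → 𝕜, (∀ i, AnalyticOnNhd 𝕜 (a i) U) →
    (∀ x ∈ U, ∑ i, a i x • v i x = 0) → ∀ i, ∀ x ∈ U, a i x = 0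

/-- The holomorphic vector fields `h` on `U` commute with each other and with the fields `g`, and
the fields `g` and `h` together are not holomorphically linearly bound on `U`. -/
def IsAbelianComplement {𝕜 : Type*} [RCLike 𝕜] {n q r : ℕ} (U : Set (Fin n → 𝕜))
    (g : Fin q → (Fin n → 𝕜) → (Fin n → 𝕜)) (h : Fin r → (Fin n → 𝕜) → (Fin n → 𝕜)) : Prop :=
  (∀ τ, AnalyticOnNhd 𝕜 (h τ) U) ∧
  (∀ τ σ, ∀ x ∈ U, VectorField.lieBracket 𝕜 (h τ) (h σ) x = 0) ∧
  (∀ l τ, ∀ x ∈ U, VectorField.lieBracket 𝕜 (g l) (h τ) x = 0) ∧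
  NotHolLinearlyBound U (Sum.elim g h)

/-- `x : T → U` is a solution, on the open set `T ⊆ 𝕜ᵐ`, of the system of equations in total
differentials `dx = f(x) dt`. -/
def IsSolution {𝕜 : Type*} [RCLike 𝕜] {n m : ℕ} (f : (Fin n → 𝕜) → Matrix (Fin n) (Fin m) 𝕜)
    (U : Set (Fin n → 𝕜)) (T : Set (Fin m → 𝕜)) (x : (Fin m → 𝕜) → (Fin n → 𝕜)) : Prop :=
  IsOpen T ∧ ∀ t ∈ T, x t ∈ U ∧
    HasFDerivAt x (LinearMap.toContinuousLinearMap (Matrix.mulVecLin (f (x t)))) t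

/-- The system `dx = f(x) dt` is completely solvable on `U`: every Cauchy problem
`x(t₀) = x₀ ∈ U` has a local solution (uniqueness is automatic for holomorphic `f`). -/
def CompletelySolvable {𝕜 : Type*} [RCLike 𝕜] {n m : ℕ}
    (f : (Fin n → 𝕜) → Matrix (Fin n) (Fin m) 𝕜) (U : Set (Fin n → 𝕜)) : Prop :=
  ∀ t₀ : Fin m → 𝕜, ∀ x₀ ∈ U, ∃ (T : Set (Fin m → 𝕜)) (x : (Fin m → 𝕜) → (Fin n → 𝕜)),
    t₀ ∈ T ∧ IsSolution f U T x ∧ x t₀ = x₀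

/-- The system `dx = f(x) dt` on `U` admits the group: the transformations of the group take
solutions to solutions, as long as they move them inside `U`. -/
def LocalAbelianGroup.AdmittedBy {𝕜 : Type*} [RCLike 𝕜] {q n m : ℕ} {Ω : Set (Fin n → 𝕜)}
    (G : LocalAbelianGroup 𝕜 q n Ω) (U : Set (Fin n → 𝕜))
    (f : (Fin n → 𝕜) → Matrix (Fin n) (Fin m) 𝕜) : Prop :=
  ∀ (T : Set (Fin m → 𝕜)) (x : (Fin m → 𝕜) → (Fin n → 𝕜)), IsSolution f U T x →
    ∀ α : Fin q → 𝕜, (∀ t ∈ T, G.MovesIn U α (x t)) →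
      IsSolution f U T (fun t => G.act α (x t))

/-- On `U` the system `dx = f(x) dt` has the form
`dxᵢ = ∑ⱼ (∑_l φ_{jl}(I(x)) g_{li}(x) + ∑_τ φ_{jτ}(I(x)) h_{τi}(x)) dtⱼ`
with functions `φ` holomorphic on a domain `W` that contains the values of `I` on `U`. -/
def HasInvariantForm {𝕜 : Type*} [RCLike 𝕜] {n m q r : ℕ} (U : Set (Fin n → 𝕜))
    (I : (Fin n → 𝕜) → (Fin r → 𝕜))
    (g : Fin q → (Fin n → 𝕜) → (Fin n → 𝕜)) (h : Fin r → (Fin n → 𝕜) → (Fin n → 𝕜))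
    (f : (Fin n → 𝕜) → Matrix (Fin n) (Fin m) 𝕜) : Prop :=
  ∃ (W : Set (Fin r → 𝕜)) (φ : Fin m → Fin q → (Fin r → 𝕜) → 𝕜)
    (ψ : Fin m → Fin r → (Fin r → 𝕜) → 𝕜),
    IsOpen W ∧ IsConnected W ∧ Set.MapsTo I U W ∧
    (∀ j l, AnalyticOnNhd 𝕜 (φ j l) W) ∧ (∀ j τ, AnalyticOnNhd 𝕜 (ψ j τ) W) ∧
    ∀ x ∈ U, ∀ i j,
      f x i j = ∑ l, φ j l (I x) * g l x i + ∑ τ, ψ j τ (I x) * h τ x i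

/-! Everything rests on two facts about the transformations `Φ_α`. Differentiating `Φ_α ∘ Φ_β =
Φ_{α+β}` shows that `dΦ_α` carries each infinitesimal operator to itself. A field `h` that commutes
with the operators is also carried to itself: along the arc `Φ_{sα} x` the difference `dΦ_{sα} h(x)
- h(Φ_{sα} x)` solves a linear homogeneous ODE with zero initial value
(`fderiv_actPair_right_of_commute`).

By the chain rule, the group is admitted as soon as `dΦ_α` carries the columns of `f` to themselves;
the converse needs a solution through every point, which complete solvability supplies. In the form
(*) the coefficients are constant along orbits and the operators are preserved, so the columns are
preserved. Conversely, when the operators form a frame, Cramer's rule expands the columns with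
analytic coefficients; preservation of the columns and uniqueness of the expansion make these
coefficients invariants, hence holomorphic functions of `I`.

For (b), fields that are independent nowhere on some open set satisfy an analytic relation there by
Cramer's rule; it persists on the whole domain by the identity theorem
(`NotHolLinearlyBound.subset_closure`). Near a regular point take a section `σ` of `I`. The map `(a,
c) ↦ Φ_a (σ c)` is a chart in which the group translates `a` and the invariants are `c`
(`exists_straightening`). Translations of `c` form the complementary group, and every invariant `u`
equals `u ∘ σ ∘ I`. -/

namespace LocalAbelianGroup

/-! ### Derivatives of the action and transport of commuting fields. -/

variable {𝕜 : Type*} [RCLike 𝕜] {q n : ℕ} {Ω : Set (Fin n → 𝕜)} (G : LocalAbelianGroup 𝕜 q n Ω)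

/-- The action as a function of the parameter and the point together. -/
def actPair (p : (Fin q → 𝕜) × (Fin n → 𝕜)) : Fin n → 𝕜 := G.act p.1 p.2

/-- The derivative of the action at the identity, as a linear function of the parameter. -/
noncomputable def gen (y : Fin n → 𝕜) : (Fin q → 𝕜) →L[𝕜] (Fin n → 𝕜) :=
  fderiv 𝕜 (fun α => G.act α y) 0

lemma infOp_eq_gen (l : Fin q) (y : Fin n → 𝕜) : G.infOp l y = G.gen y (Pi.single l 1) := rfl

lemma gen_apply (y : Fin n → 𝕜) (a : Fin q → 𝕜) : G.gen y a = ∑ l, a l • G.infOp l y := by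
  conv_lhs => rw [pi_eq_sum_univ' a]
  simp [map_sum, infOp_eq_gen, Pi.single]

lemma isOpen_base (G : LocalAbelianGroup 𝕜 q n Ω) : IsOpen Ω := by
  have h : Ω = (fun x : Fin n → 𝕜 => ((0 : Fin q → 𝕜), x)) ⁻¹' G.dom := by
    ext x
    exact ⟨G.zero_mem x, G.snd_mem 0 x⟩
  rw [h]
  exact G.isOpen_dom.preimage (by fun_prop)

lemma analyticAt_actPair {p : (Fin q → 𝕜) × (Fin n → 𝕜)} (hp : p ∈ G.dom) :
    AnalyticAt 𝕜 G.actPair p := G.analytic_act p hp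

lemma hasFDerivAt_actPair {p : (Fin q → 𝕜) × (Fin n → 𝕜)} (hp : p ∈ G.dom) :
    HasFDerivAt G.actPair (fderiv 𝕜 G.actPair p) p :=
  (G.analyticAt_actPair hp).differentiableAt.hasFDerivAt

lemma hasFDerivAt_act_left {α : Fin q → 𝕜} {x : Fin n → 𝕜} (hp : (α, x) ∈ G.dom) :
    HasFDerivAt (fun β => G.act β x)
      ((fderiv 𝕜 G.actPair (α, x)).comp (ContinuousLinearMap.inl 𝕜 _ _)) α :=
  HasFDerivAt.comp (f := fun β => (β, x)) α (G.hasFDerivAt_actPair hp) (hasFDerivAt_prodMk_left α x)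

lemma hasFDerivAt_act_right {α : Fin q → 𝕜} {x : Fin n → 𝕜} (hp : (α, x) ∈ G.dom) :
    HasFDerivAt (G.act α)
      ((fderiv 𝕜 G.actPair (α, x)).comp (ContinuousLinearMap.inr 𝕜 _ _)) x :=
  HasFDerivAt.comp (f := fun y => (α, y)) x (G.hasFDerivAt_actPair hp) (hasFDerivAt_prodMk_right α x)

lemma gen_eq {y : Fin n → 𝕜} (hy : y ∈ Ω) :
    G.gen y = (fderiv 𝕜 G.actPair (0, y)).comp (ContinuousLinearMap.inl 𝕜 _ _) :=
  (G.hasFDerivAt_act_left (G.zero_mem y hy)).fderiv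

lemma hasFDerivAt_gen {y : Fin n → 𝕜} (hy : y ∈ Ω) :
    HasFDerivAt (fun β => G.act β y) (G.gen y) 0 := by
  rw [G.gen_eq hy]
  exact G.hasFDerivAt_act_left (G.zero_mem y hy)

lemma analyticOnNhd_gen (a : Fin q → 𝕜) : AnalyticOnNhd 𝕜 (fun y => G.gen y a) Ω := by
  intro y hy
  have h1 : AnalyticAt 𝕜 (fun z => fderiv 𝕜 G.actPair ((0 : Fin q → 𝕜), z)) y :=
    (G.analyticAt_actPair (G.zero_mem y hy)).fderiv.comp₂ analyticAt_const analyticAt_id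
  have h2 : AnalyticAt 𝕜 (fun z => fderiv 𝕜 G.actPair ((0 : Fin q → 𝕜), z) (a, 0)) y :=
    AnalyticAt.fun_comp ((ContinuousLinearMap.apply 𝕜 (Fin n → 𝕜) (a, (0 : Fin n → 𝕜))).analyticAt _) h1
  refine h2.congr ?_
  filter_upwards [G.isOpen_base.mem_nhds hy] with z hz
  simp [G.gen_eq hz]

lemma analyticOnNhd_infOp (l : Fin q) : AnalyticOnNhd 𝕜 (G.infOp l) Ω :=
  G.analyticOnNhd_gen (Pi.single l 1)

lemma eventually_zero_mem {y : Fin n → 𝕜} (hy : y ∈ Ω) :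
    ∀ᶠ β in 𝓝 (0 : Fin q → 𝕜), (β, y) ∈ G.dom :=
  (show ContinuousAt (fun β : Fin q → 𝕜 => (β, y)) 0 by fun_prop).eventually
    (G.isOpen_dom.mem_nhds (G.zero_mem y hy))

/-- Differentiate `Φ_β (Φ_α x) = Φ_{β+α} x` in `β` at `β = 0`. -/
lemma fderiv_actPair_left {α : Fin q → 𝕜} {x : Fin n → 𝕜} (hp : (α, x) ∈ G.dom)
    (b : Fin q → 𝕜) : fderiv 𝕜 G.actPair (α, x) (b, 0) = G.gen (G.act α x) b := by
  have h1 : HasFDerivAt (fun β => G.act (β + α) x)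
      ((fderiv 𝕜 G.actPair (α, x)).comp (ContinuousLinearMap.inl 𝕜 _ _)) 0 := by
    have h0 : HasFDerivAt (fun β : Fin q → 𝕜 => β + α) (ContinuousLinearMap.id 𝕜 _) 0 :=
      (hasFDerivAt_id 0).add_const α
    have h1 := HasFDerivAt.comp (g := fun β => G.act β x)
      (g' := (fderiv 𝕜 G.actPair (α, x)).comp (ContinuousLinearMap.inl 𝕜 _ _)) 0
      (by simpa using G.hasFDerivAt_act_left hp) h0
    exact h1
  have h2 : (fun β => G.act β (G.act α x)) =ᶠ[𝓝 0] fun β => G.act (β + α) x := by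
    have h3 : ∀ᶠ β in 𝓝 (0 : Fin q → 𝕜), (β + α, x) ∈ G.dom :=
      (show ContinuousAt (fun β : Fin q → 𝕜 => (β + α, x)) 0 by fun_prop).eventually
        (G.isOpen_dom.mem_nhds (by simpa using hp))
    filter_upwards [G.eventually_zero_mem (G.act_mem α x hp), h3] with β hβ hβ'
    exact G.act_add β α x hp hβ hβ'
  have h4 := (G.hasFDerivAt_gen (G.act_mem α x hp)).unique (h1.congr_of_eventuallyEq h2)
  rw [h4]
  simp

/-- Differentiate `Φ_α (Φ_β x) = Φ_{α+β} x` in `β` at `β = 0`. The right side has the same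
derivative as in `fderiv_actPair_left`; this is where commutativity of the group enters. -/
lemma fderiv_actPair_right_gen {α : Fin q → 𝕜} {x : Fin n → 𝕜} (hp : (α, x) ∈ G.dom)
    (b : Fin q → 𝕜) :
    fderiv 𝕜 G.actPair (α, x) (0, G.gen x b) = G.gen (G.act α x) b := by
  have hx := G.snd_mem α x hp
  have h1 : HasFDerivAt (fun β => G.act (α + β) x)
      ((fderiv 𝕜 G.actPair (α, x)).comp (ContinuousLinearMap.inl 𝕜 _ _)) 0 := by
    have h0 : HasFDerivAt (fun β : Fin q → 𝕜 => α + β) (ContinuousLinearMap.id 𝕜 _) 0 :=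
      (hasFDerivAt_id 0).const_add α
    have h1 := HasFDerivAt.comp (g := fun β => G.act β x)
      (g' := (fderiv 𝕜 G.actPair (α, x)).comp (ContinuousLinearMap.inl 𝕜 _ _)) 0
      (by simpa using G.hasFDerivAt_act_left hp) h0
    exact h1
  have h2 : HasFDerivAt (fun β => G.act α (G.act β x))
      (((fderiv 𝕜 G.actPair (α, x)).comp (ContinuousLinearMap.inr 𝕜 _ _)).comp (G.gen x)) 0 := by
    refine HasFDerivAt.comp 0 ?_ (G.hasFDerivAt_gen hx)
    rw [G.act_zero x hx]
    exact G.hasFDerivAt_act_right hp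
  have h3 : (fun β => G.act α (G.act β x)) =ᶠ[𝓝 0] fun β => G.act (α + β) x := by
    have h4 : ∀ᶠ β in 𝓝 (0 : Fin q → 𝕜), (α + β, x) ∈ G.dom :=
      (show ContinuousAt (fun β : Fin q → 𝕜 => (α + β, x)) 0 by fun_prop).eventually
        (G.isOpen_dom.mem_nhds (by simpa using hp))
    have h5 : ∀ᶠ β in 𝓝 (0 : Fin q → 𝕜), (α, G.act β x) ∈ G.dom := by
      have hc : ContinuousAt (fun β => (α, G.act β x)) 0 :=
        continuousAt_const.prodMk (G.hasFDerivAt_gen hx).continuousAt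
      exact hc.eventually (G.isOpen_dom.mem_nhds (by simpa [G.act_zero x hx] using hp))
    filter_upwards [G.eventually_zero_mem hx, h4, h5] with β hβ hβ' hβ''
    exact G.act_add α β x hβ hβ'' hβ'
  have h4 := h2.unique (h1.congr_of_eventuallyEq h3)
  have h5 := congrArg (fun L => L b) h4
  simpa [G.fderiv_actPair_left hp] using h5

/-- The mixed second derivative of the action. -/
lemma fderiv_fderiv_actPair {α β : Fin q → 𝕜} {x w : Fin n → 𝕜} (hp : (α, x) ∈ G.dom) :
    fderiv 𝕜 (fderiv 𝕜 G.actPair) (α, x) (β, 0) (0, w) =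
      fderiv 𝕜 (fun y => G.gen y β) (G.act α x) (fderiv 𝕜 G.actPair (α, x) (0, w)) := by
  have ha := G.analyticAt_actPair hp
  have hsymm : IsSymmSndFDerivAt 𝕜 G.actPair (α, x) :=
    ha.contDiffAt.isSymmSndFDerivAt (n := ⊤) le_top
  rw [hsymm.eq]
  have h1 : HasFDerivAt (fun p => fderiv 𝕜 G.actPair p (β, 0))
      ((fderiv 𝕜 (fderiv 𝕜 G.actPair) (α, x)).flip (β, 0)) (α, x) := by
    simpa using ha.fderiv.differentiableAt.hasFDerivAt.clm_apply (hasFDerivAt_const (β, 0) (α, x))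
  have h2 : HasFDerivAt (fun p => G.gen (G.actPair p) β)
      ((fderiv 𝕜 (fun y => G.gen y β) (G.act α x)).comp (fderiv 𝕜 G.actPair (α, x))) (α, x) :=
    HasFDerivAt.comp (α, x) (g := fun y => G.gen y β)
      (G.analyticOnNhd_gen β _ (G.act_mem α x hp)).differentiableAt.hasFDerivAt
      (G.hasFDerivAt_actPair hp)
  -- The flow equation holds on a neighbourhood, so it may be differentiated in the direction `(0,
  -- w)`; symmetry of the second derivative was used to put the parameter derivative inside.
  have h3 : (fun p => fderiv 𝕜 G.actPair p (β, 0)) =ᶠ[𝓝 (α, x)]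
      fun p => G.gen (G.actPair p) β := by
    filter_upwards [G.isOpen_dom.mem_nhds hp] with p hp
    exact G.fderiv_actPair_left hp β
  have h4 := congrArg (fun L => L (0, w)) (h1.unique (h2.congr_of_eventuallyEq h3))
  simpa using h4

/-- A vector field that commutes with the infinitesimal operators is preserved by the
transformations of the group. -/
lemma fderiv_actPair_right_of_commute {U : Set (Fin n → 𝕜)}
    {h : (Fin n → 𝕜) → (Fin n → 𝕜)} (hh : AnalyticOnNhd 𝕜 h U)
    (hc : ∀ l, ∀ x ∈ U, VectorField.lieBracket 𝕜 (G.infOp l) h x = 0)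
    {α : Fin q → 𝕜} {x : Fin n → 𝕜} (hm : G.MovesIn U α x) :
    fderiv 𝕜 G.actPair (α, x) (0, h x) = h (G.act α x) := by
  have hmem : ∀ s ∈ Set.Icc (0 : ℝ) 1, ((s : 𝕜) • α, x) ∈ G.dom ∧ G.act ((s : 𝕜) • α) x ∈ U :=
    fun s hs => hm s hs.1 hs.2
  have hΩ : ∀ s ∈ Set.Icc (0 : ℝ) 1, G.act ((s : 𝕜) • α) x ∈ Ω :=
    fun s hs => G.act_mem _ _ (hmem s hs).1
  have hcomm : ∀ y ∈ U, y ∈ Ω →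
      fderiv 𝕜 h y (G.gen y α) = fderiv 𝕜 (fun z => G.gen z α) y (h y) := by
    intro y hy hyΩ
    have h1 : (fun z => G.gen z α) = fun z => ∑ l, α l • G.infOp l z := by
      funext z; exact G.gen_apply z α
    have h2 : HasFDerivAt (fun z => ∑ l, α l • G.infOp l z)
        (∑ l, α l • fderiv 𝕜 (G.infOp l) y) y :=
      HasFDerivAt.fun_sum fun l _ =>
        ((G.analyticOnNhd_infOp l y hyΩ).differentiableAt.hasFDerivAt).const_smul (α l)
    rw [h1, h2.fderiv, G.gen_apply, map_sum]
    simp only [sum_apply, smul_apply, map_smul]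
    refine Finset.sum_congr rfl fun l _ => ?_
    have := hc l y hy
    rw [VectorField.lieBracket_eq] at this
    rw [sub_eq_zero.mp this]
  -- Both `v s` and `h` along the arc solve the variational equation `y' = B s y`: the first by the
  -- mixed second derivative, the second by `hcomm`. Time is real even when `𝕜 = ℂ`, so a real
  -- Gronwall estimate shows that their difference `z` vanishes at `s = 1`.
  set v : ℝ → (Fin n → 𝕜) := fun s => fderiv 𝕜 G.actPair ((s : 𝕜) • α, x) (0, h x) with hv
  set z : ℝ → (Fin n → 𝕜) := fun s => v s - h (G.act ((s : 𝕜) • α) x) with hz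
  set B : ℝ → ((Fin n → 𝕜) →L[𝕜] (Fin n → 𝕜)) :=
    fun s => fderiv 𝕜 (fun y => G.gen y α) (G.act ((s : 𝕜) • α) x) with hB
  have hline : ∀ s : ℝ, HasDerivAt (fun s : ℝ => ((s : 𝕜) • α, x)) (α, 0) s := by
    intro s
    have h1 : HasDerivAt (fun s : ℝ => (s : 𝕜)) 1 s := by
      simpa using (RCLike.ofRealCLM (K := 𝕜)).hasDerivAt (x := s)
    simpa using (h1.smul_const α).prodMk (hasDerivAt_const s x)
  have hyder : ∀ s ∈ Set.Icc (0 : ℝ) 1, HasDerivAt (fun s : ℝ => G.act ((s : 𝕜) • α) x)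
      (G.gen (G.act ((s : 𝕜) • α) x) α) s := by
    intro s hs
    have := ((G.hasFDerivAt_actPair (hmem s hs).1).restrictScalars ℝ).comp_hasDerivAt s (hline s)
    rw [← G.fderiv_actPair_left (hmem s hs).1]
    exact this
  have hzder : ∀ s ∈ Set.Icc (0 : ℝ) 1, HasDerivAt z (B s (z s)) s := by
    intro s hs
    have h1 : HasDerivAt v (B s (v s)) s := by
      have h2 : HasFDerivAt (fun p => fderiv 𝕜 G.actPair p (0, h x))
          ((fderiv 𝕜 (fderiv 𝕜 G.actPair) ((s : 𝕜) • α, x)).flip (0, h x)) ((s : 𝕜) • α, x) := by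
        simpa using (G.analyticAt_actPair (hmem s hs).1).fderiv.differentiableAt.hasFDerivAt.clm_apply
          (hasFDerivAt_const (0, h x) ((s : 𝕜) • α, x))
      have h3 := (h2.restrictScalars ℝ).comp_hasDerivAt s (hline s)
      have h4 := G.fderiv_fderiv_actPair (β := α) (w := h x) (hmem s hs).1
      simp only [hB, hv]
      rw [← h4]
      exact h3
    have h5 : HasDerivAt (fun s : ℝ => h (G.act ((s : 𝕜) • α) x))
        (B s (h (G.act ((s : 𝕜) • α) x))) s := by
      have h6 := ((hh _ (hmem s hs).2).differentiableAt.hasFDerivAt.restrictScalars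
        ℝ).comp_hasDerivAt s (hyder s hs)
      simp only [hB]
      rw [← hcomm _ (hmem s hs).2 (hΩ s hs)]
      exact h6
    have h7 := h1.sub h5
    rw [← map_sub] at h7
    exact h7
  have hBc : ContinuousOn B (Set.Icc 0 1) := by
    intro s hs
    refine ContinuousAt.continuousWithinAt ?_
    exact ContinuousAt.comp (g := fderiv 𝕜 (fun y => G.gen y α))
      (f := fun s : ℝ => G.act ((s : 𝕜) • α) x)
      (G.analyticOnNhd_gen α _ (hΩ s hs)).fderiv.continuousAt (hyder s hs).continuousAt
  obtain ⟨K, hK⟩ := isCompact_Icc.exists_bound_of_continuousOn hBc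
  have hz0 : z 0 = 0 := by
    have hx : x ∈ Ω := G.snd_mem _ _ (hmem 0 (by simp)).1
    have h1 : fderiv 𝕜 G.actPair (0, x) (0, h x) = h x := by
      have h2 := G.hasFDerivAt_act_right (G.zero_mem x hx)
      have h3 : G.act 0 =ᶠ[𝓝 x] id := by
        filter_upwards [G.isOpen_base.mem_nhds hx] with y hy using G.act_zero y hy
      have h4 := (h2.congr_of_eventuallyEq h3.symm).unique (hasFDerivAt_id x)
      simpa using congrArg (fun L => L (h x)) h4
    simp [hz, hv, G.act_zero x hx, h1]
  have := eq_zero_of_abs_deriv_le_mul_abs_self_of_eq_zero_right (f := z) (f' := fun s => B s (z s))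
    (K := K) (a := 0) (b := 1) (fun s hs => (hzder s hs).continuousAt.continuousWithinAt)
    (fun s hs => (hzder s ⟨hs.1, hs.2.le⟩).hasDerivWithinAt) hz0
    (fun s hs => (B s).le_of_opNorm_le (hK s ⟨hs.1, hs.2.le⟩) _) 1 (by simp)
  simpa [hz, hv, sub_eq_zero] using this

end LocalAbelianGroup

/-! ### Analytic linear algebra and auxiliary facts on the invariant form. -/

section Matrix

variable {𝕜 : Type*} [RCLike 𝕜] {E : Type*} [NormedAddCommGroup E] [NormedSpace 𝕜 E]
  {κ : Type*} [Fintype κ]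

lemma AnalyticAt.pi_apply {F : E → κ → 𝕜} {x : E} (hF : AnalyticAt 𝕜 F x) (i : κ) :
    AnalyticAt 𝕜 (fun y => F y i) x :=
  AnalyticAt.fun_comp ((ContinuousLinearMap.proj (R := 𝕜) (φ := fun _ : κ => 𝕜) i).analyticAt _) hF

variable [DecidableEq κ]

lemma AnalyticAt.matrix_det {M : E → Matrix κ κ 𝕜} {x : E}
    (hM : ∀ i j, AnalyticAt 𝕜 (fun y => M y i j) x) : AnalyticAt 𝕜 (fun y => (M y).det) x := by
  simp only [Matrix.det_apply']
  exact Finset.analyticAt_fun_sum _ fun σ _ =>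
    analyticAt_const.mul (Finset.analyticAt_fun_prod _ fun i _ => hM _ _)

lemma AnalyticAt.matrix_cramer {M : E → Matrix κ κ 𝕜} {b : E → κ → 𝕜} {x : E}
    (hM : ∀ i j, AnalyticAt 𝕜 (fun y => M y i j) x) (hb : ∀ i, AnalyticAt 𝕜 (fun y => b y i) x)
    (k : κ) : AnalyticAt 𝕜 (fun y => (M y).cramer (b y) k) x := by
  simp only [Matrix.cramer_apply]
  refine AnalyticAt.matrix_det fun i j => ?_
  by_cases hj : j = k
  · simpa [Matrix.updateCol_apply, hj] using hb i
  · simpa [Matrix.updateCol_apply, hj] using hM i j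

/-- The coefficients of an analytic vector field in an analytic frame are analytic. -/
lemma exists_analytic_coeff {n : ℕ} {ι : Type*} [Fintype ι] (hcard : Fintype.card ι = n)
    {U : Set E} {v : ι → E → (Fin n → 𝕜)} (hv : ∀ i, AnalyticOnNhd 𝕜 (v i) U)
    (hind : ∀ x ∈ U, LinearIndependent 𝕜 (fun i => v i x))
    {w : E → (Fin n → 𝕜)} (hw : AnalyticOnNhd 𝕜 w U) :
    ∃ a : ι → E → 𝕜, (∀ i, AnalyticOnNhd 𝕜 (a i) U) ∧ ∀ x ∈ U, w x = ∑ i, a i x • v i x := by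
  obtain ⟨e⟩ : Nonempty (ι ≃ Fin n) := ⟨Fintype.equivFinOfCardEq hcard⟩
  set M : E → Matrix (Fin n) (Fin n) 𝕜 := fun x => Matrix.of fun i j => v (e.symm j) x i with hM
  have hMa : ∀ x ∈ U, ∀ i j, AnalyticAt 𝕜 (fun y => M y i j) x :=
    fun x hx i j => (hv (e.symm j) x hx).pi_apply i
  have hdet : ∀ x ∈ U, (M x).det ≠ 0 := by
    intro x hx
    have h1 : LinearIndependent 𝕜 (M x).col := (hind x hx).comp e.symm e.symm.injective
    rw [Matrix.linearIndependent_cols_iff_isUnit, Matrix.isUnit_iff_isUnit_det] at h1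
    exact h1.ne_zero
  refine ⟨fun i x => ((M x).det)⁻¹ * (M x).cramer (w x) (e i), fun i x hx => ?_, fun x hx => ?_⟩
  · exact ((AnalyticAt.matrix_det (hMa x hx)).inv (hdet x hx)).mul
      (AnalyticAt.matrix_cramer (hMa x hx) (fun i => (hw x hx).pi_apply i) _)
  · have h1 := Matrix.mulVec_cramer (M x) (w x)
    have h2 : w x = (M x).det⁻¹ • (M x).mulVec ((M x).cramer (w x)) := by
      rw [h1, smul_smul, inv_mul_cancel₀ (hdet x hx), one_smul]
    rw [← e.symm.sum_comp]
    funext i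
    have h3 : w x i = (M x).det⁻¹ * ∑ j, M x i j * (M x).cramer (w x) j := congrFun h2 i
    rw [h3, Finset.mul_sum, Finset.sum_apply]
    refine Finset.sum_congr rfl fun j _ => ?_
    simp only [Equiv.apply_symm_apply, Pi.smul_apply, smul_eq_mul]
    rw [show M x i j = v (e.symm j) x i from rfl]
    ring

/-- Reduces an identity between the differentials of solutions to one between the columns of the
system, by evaluation on the standard basis. -/
lemma comp_mulVecLin_eq {n m : ℕ} (L : (Fin n → 𝕜) →L[𝕜] (Fin n → 𝕜))
    {M N : Matrix (Fin n) (Fin m) 𝕜} (h : ∀ j, L (fun i => M i j) = fun i => N i j) :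
    L.comp (LinearMap.toContinuousLinearMap M.mulVecLin) =
      LinearMap.toContinuousLinearMap N.mulVecLin := by
  refine ContinuousLinearMap.coe_injective (LinearMap.pi_ext' fun j => LinearMap.ext_ring ?_)
  have h1 : ∀ A : Matrix (Fin n) (Fin m) 𝕜, A.mulVec (Pi.single j 1) = fun i => A i j := by
    intro A; funext i; simp
  simpa [h1] using h j

end Matrix

/-- Needed because the cylindrical coordinates agree with `infOp` only at points of the domain, not
as functions on the whole space. -/
lemma HasInvariantForm.congr {𝕜 : Type*} [RCLike 𝕜] {n m q r : ℕ} {U : Set (Fin n → 𝕜)}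
    {I : (Fin n → 𝕜) → (Fin r → 𝕜)} {g g' : Fin q → (Fin n → 𝕜) → (Fin n → 𝕜)}
    {h : Fin r → (Fin n → 𝕜) → (Fin n → 𝕜)} {f : (Fin n → 𝕜) → Matrix (Fin n) (Fin m) 𝕜}
    (hg : ∀ l, ∀ x ∈ U, g l x = g' l x) (hf : HasInvariantForm U I g h f) :
    HasInvariantForm U I g' h f := by
  obtain ⟨W, φ, ψ, h1, h2, h3, h4, h5, h6⟩ := hf
  refine ⟨W, φ, ψ, h1, h2, h3, h4, h5, fun x hx i j => ?_⟩
  rw [h6 x hx]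
  simp only [hg _ x hx]

/-- Finitely many functions analytic around a connected set are analytic on a common domain. -/
lemma exists_domain_analyticOnNhd {𝕜 : Type*} [RCLike 𝕜] {r : ℕ} {κ : Type*} [Finite κ]
    {S : Set (Fin r → 𝕜)} (hS : IsConnected S) {φ : κ → (Fin r → 𝕜) → 𝕜}
    (hφ : ∀ k, AnalyticOnNhd 𝕜 (φ k) S) :
    ∃ W, IsOpen W ∧ IsConnected W ∧ S ⊆ W ∧ ∀ k, AnalyticOnNhd 𝕜 (φ k) W := by
  obtain ⟨c, hc⟩ := hS.nonempty
  -- The common set of analyticity is open but may be disconnected; the component that contains `S`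
  -- is the required domain.
  set A : Set (Fin r → 𝕜) := ⋂ k, {z | AnalyticAt 𝕜 (φ k) z} with hA
  have hAo : IsOpen A := isOpen_iInter_of_finite fun k => isOpen_analyticAt 𝕜 (φ k)
  have hSA : S ⊆ A := fun z hz => Set.mem_iInter.mpr fun k => hφ k z hz
  refine ⟨connectedComponentIn A c, hAo.connectedComponentIn,
    isConnected_connectedComponentIn_iff.mpr (hSA hc),
    hS.isPreconnected.subset_connectedComponentIn hc hSA, fun k z hz => ?_⟩
  exact Set.mem_iInter.mp (connectedComponentIn_subset _ _ hz) k

/-! ### Admitted groups and the invariant form. -/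

namespace LocalAbelianGroup

variable {𝕜 : Type*} [RCLike 𝕜] {q n m : ℕ} {Ω : Set (Fin n → 𝕜)} {G : LocalAbelianGroup 𝕜 q n Ω}
  {U : Set (Fin n → 𝕜)} {α : Fin q → 𝕜} {x : Fin n → 𝕜}

lemma MovesIn.mono {V : Set (Fin n → 𝕜)} (hm : G.MovesIn U α x) (h : U ⊆ V) : G.MovesIn V α x :=
  fun s h0 h1 => ⟨(hm s h0 h1).1, h (hm s h0 h1).2⟩

lemma MovesIn.mem_dom (hm : G.MovesIn U α x) : (α, x) ∈ G.dom := by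
  simpa using (hm 1 zero_le_one le_rfl).1

lemma MovesIn.act_mem (hm : G.MovesIn U α x) : G.act α x ∈ U := by
  simpa using (hm 1 zero_le_one le_rfl).2

lemma IsInvariant.mono {V : Set (Fin n → 𝕜)} {u : (Fin n → 𝕜) → 𝕜} (hu : G.IsInvariant V u)
    (h : U ⊆ V) : G.IsInvariant U u :=
  fun α x hx hm => hu α x (h hx) (hm.mono h)

/-- The condition of moving inside an open set is open in the point. -/
lemma MovesIn.eventually (hU : IsOpen U) (hm : G.MovesIn U α x) :
    ∀ᶠ y in 𝓝 x, G.MovesIn U α y := by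
  have h1 : ∀ s ∈ Set.Icc (0 : ℝ) 1, ∀ᶠ p : (Fin n → 𝕜) × ℝ in 𝓝 (x, s),
      ((p.2 : 𝕜) • α, p.1) ∈ G.dom ∧ G.act ((p.2 : 𝕜) • α) p.1 ∈ U := by
    intro s hs
    have hp := hm s hs.1 hs.2
    have hc : ContinuousAt (fun p : (Fin n → 𝕜) × ℝ => ((p.2 : 𝕜) • α, p.1)) (x, s) := by
      have : Continuous fun p : (Fin n → 𝕜) × ℝ => (p.2 : 𝕜) :=
        RCLike.continuous_ofReal.comp continuous_snd
      exact ((this.smul continuous_const).prodMk continuous_fst).continuousAt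
    have hc2 : ContinuousAt (fun p : (Fin n → 𝕜) × ℝ => G.act ((p.2 : 𝕜) • α) p.1) (x, s) :=
      ContinuousAt.comp (g := G.actPair) (f := fun p : (Fin n → 𝕜) × ℝ => ((p.2 : 𝕜) • α, p.1))
        (G.analyticAt_actPair hp.1).continuousAt hc
    exact (hc.eventually (G.isOpen_dom.mem_nhds hp.1)).and (hc2.eventually (hU.mem_nhds hp.2))
  -- Tube lemma: the condition is open in `(y, s)` and `s` runs over a compact interval.
  filter_upwards [isCompact_Icc.eventually_forall_of_forall_eventually
    (P := fun y (s : ℝ) => ((s : 𝕜) • α, y) ∈ G.dom ∧ G.act ((s : 𝕜) • α) y ∈ U) h1] with y hy s h0 h1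
  exact hy s ⟨h0, h1⟩

variable {f : (Fin n → 𝕜) → Matrix (Fin n) (Fin m) 𝕜}

/-- A group is admitted if its transformations preserve the columns of the system. -/
lemma admittedBy_of_columns
    (hf : ∀ α x, x ∈ U → G.MovesIn U α x → ∀ j,
      fderiv 𝕜 G.actPair (α, x) (0, fun i => f x i j) = fun i => f (G.act α x) i j) :
    G.AdmittedBy U f := by
  intro T x hx α hm
  refine ⟨hx.1, fun t ht => ⟨(hm t ht).act_mem, ?_⟩⟩
  have h1 := HasFDerivAt.comp t (G.hasFDerivAt_act_right (hm t ht).mem_dom) (hx.2 t ht).2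
  rw [comp_mulVecLin_eq (N := f (G.act α (x t))) _ (fun j => by
    simpa using hf α (x t) (hx.2 t ht).1 (hm t ht) j)] at h1
  exact h1

/-- The transformations of an admitted group preserve the columns of the system. -/
lemma AdmittedBy.columns (hU : IsOpen U) (hf : G.AdmittedBy U f) (hs : CompletelySolvable f U)
    (hx : x ∈ U) (hm : G.MovesIn U α x) (j : Fin m) :
    fderiv 𝕜 G.actPair (α, x) (0, fun i => f x i j) = fun i => f (G.act α x) i j := by
  obtain ⟨T, ξ, h0, ⟨hT, hξ⟩, rfl⟩ := hs 0 x hx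
  obtain ⟨N, hN, hNo, hxN⟩ := eventually_nhds_iff.mp (hm.eventually hU)
  have hc : ContinuousOn ξ T := fun t ht => (hξ t ht).2.continuousAt.continuousWithinAt
  -- The solution is cut down to times at which `α` still moves its points inside `U`, as the
  -- definition of admitting demands. The derivative of its image at time `0` is then known twice:
  -- from the chain rule and from the system.
  have hsol : IsSolution f U (T ∩ ξ ⁻¹' N) ξ :=
    ⟨hc.isOpen_inter_preimage hT hNo, fun t ht => hξ t ht.1⟩
  have h1 := (hf _ ξ hsol α fun t ht => hN _ ht.2).2 0 ⟨h0, hxN⟩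
  have h2 := HasFDerivAt.comp 0 (G.hasFDerivAt_act_right hm.mem_dom) (hξ 0 h0).2
  have h3 := congrArg (fun L => L (Pi.single j 1)) (h2.unique h1.2)
  have h4 : ∀ A : Matrix (Fin n) (Fin m) 𝕜, A.mulVec (Pi.single j 1) = fun i => A i j := by
    intro A; funext i; simp
  simpa [h4] using h3

variable {I : (Fin n → 𝕜) → (Fin (n - q) → 𝕜)} {h : Fin (n - q) → (Fin n → 𝕜) → (Fin n → 𝕜)}

lemma fderiv_actPair_right_infOp (hp : (α, x) ∈ G.dom) (l : Fin q) :
    fderiv 𝕜 G.actPair (α, x) (0, G.infOp l x) = G.infOp l (G.act α x) :=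
  G.fderiv_actPair_right_gen hp _

/-- A system of the invariant form admits the group. -/
lemma admittedBy_of_hasInvariantForm (hI : ∀ τ, G.IsInvariant U (fun x => I x τ))
    (hh : IsAbelianComplement U G.infOp h) (hf : HasInvariantForm U I G.infOp h f) :
    G.AdmittedBy U f := by
  obtain ⟨W, φ, ψ, -, -, -, -, -, hform⟩ := hf
  have hcol : ∀ x ∈ U, ∀ j, (fun i => f x i j) =
      ∑ l, φ j l (I x) • G.infOp l x + ∑ τ, ψ j τ (I x) • h τ x := by
    intro x hx j
    funext i
    simp [hform x hx i j]
  refine admittedBy_of_columns fun α x hx hm j => ?_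
  have hIx : I (G.act α x) = I x := funext fun τ => hI τ α x hx hm
  have hz : ∀ w : Fin n → 𝕜, fderiv 𝕜 G.actPair (α, x) (0, w) =
      (fderiv 𝕜 G.actPair (α, x)).comp (ContinuousLinearMap.inr 𝕜 _ _) w := fun w => by simp
  have h1 : ∀ l, (fderiv 𝕜 G.actPair (α, x)).comp (ContinuousLinearMap.inr 𝕜 _ _) (G.infOp l x) =
      G.infOp l (G.act α x) := fun l => by
    rw [← hz]; exact fderiv_actPair_right_infOp hm.mem_dom l
  have h2 : ∀ τ, (fderiv 𝕜 G.actPair (α, x)).comp (ContinuousLinearMap.inr 𝕜 _ _) (h τ x) =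
      h τ (G.act α x) := fun τ => by
    rw [← hz]
    exact G.fderiv_actPair_right_of_commute (hh.1 τ) (fun l => hh.2.2.1 l τ) hm
  rw [hcol x hx j, hcol _ hm.act_mem j, hIx, hz, map_add, map_sum, map_sum]
  simp only [map_smul, h1, h2]

/-- If the invariants are a basis and the operators are a frame, a completely solvable system that
admits the group has the invariant form. -/
lemma AdmittedBy.hasInvariantForm (hqn : q ≤ n) (hU : IsOpen U) (hUc : IsConnected U) (hUΩ : U ⊆ Ω)
    (hh : IsAbelianComplement U G.infOp h)
    (hind : ∀ x ∈ U, LinearIndependent 𝕜 (fun i => Sum.elim G.infOp h i x))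
    (hI : G.IsInvariantBasis U I) (hf : ∀ i j, AnalyticOnNhd 𝕜 (fun x => f x i j) U)
    (hs : CompletelySolvable f U) (hadm : G.AdmittedBy U f) :
    HasInvariantForm U I G.infOp h f := by
  have hv : ∀ i, AnalyticOnNhd 𝕜 (Sum.elim G.infOp h i) U := by
    rintro (l | τ)
    · exact (G.analyticOnNhd_infOp l).mono hUΩ
    · exact hh.1 τ
  have hex : ∀ j : Fin m, ∃ a : Fin q ⊕ Fin (n - q) → (Fin n → 𝕜) → 𝕜,
      (∀ i, AnalyticOnNhd 𝕜 (a i) U) ∧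
      ∀ x ∈ U, (fun i => f x i j) = ∑ i, a i x • Sum.elim G.infOp h i x := fun j =>
    exists_analytic_coeff (by simp; omega) hv hind
      (w := fun x i => f x i j) (fun x hx => AnalyticAt.pi fun i => hf i j x hx)
  choose a ha hcol using hex
  have hpush : ∀ α x, G.MovesIn U α x → ∀ i,
      (fderiv 𝕜 G.actPair (α, x)).comp (ContinuousLinearMap.inr 𝕜 _ _)
        (Sum.elim G.infOp h i x) = Sum.elim G.infOp h i (G.act α x) := by
    rintro α x hm (l | τ)
    · simpa using fderiv_actPair_right_infOp hm.mem_dom l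
    · simpa using G.fderiv_actPair_right_of_commute (hh.1 τ) (fun l => hh.2.2.1 l τ) hm
  have hinv : ∀ j i, G.IsInvariant U (a j i) := by
    intro j i α x hx hm
    have h1 : (fderiv 𝕜 G.actPair (α, x)).comp (ContinuousLinearMap.inr 𝕜 _ _)
        (fun i => f x i j) = fun i => f (G.act α x) i j := by
      simpa using hadm.columns hU hs hx hm j
    rw [hcol j x hx, hcol j _ hm.act_mem, map_sum] at h1
    simp only [map_smul, hpush α x hm] at h1
    -- Two expansions of the same vector in the frame at `act α x`: the transported column and the
    -- column there.
    have h2 : ∑ i, (a j i x - a j i (G.act α x)) • Sum.elim G.infOp h i (G.act α x) = 0 := by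
      simp only [sub_smul, Finset.sum_sub_distrib, h1, sub_self]
    have h3 := Fintype.linearIndependent_iff.mp (hind _ hm.act_mem) _ h2 i
    exact (sub_eq_zero.mp h3).symm
  choose φ hφ hφa using fun j i => hI.2 (a j i) (ha j i) (hinv j i)
  -- `I '' U` need not be open, so the finitely many coefficients are extended to a common domain.
  obtain ⟨W, hWo, hWc, hUW, hW⟩ := exists_domain_analyticOnNhd
    (κ := Fin m × (Fin q ⊕ Fin (n - q))) (hUc.image I hI.1.1.continuousOn)
    (φ := fun k => φ k.1 k.2) (fun k => hφ k.1 k.2)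
  refine ⟨W, fun j l => φ j (.inl l), fun j τ => φ j (.inr τ), hWo, hWc,
    fun x hx => hUW ⟨x, hx, rfl⟩, fun j l => hW (j, .inl l), fun j τ => hW (j, .inr τ),
    fun x hx i j => ?_⟩
  have h1 := congrFun (hcol j x hx) i
  simpa [Fintype.sum_sum_type, hφa j _ x hx] using h1

end LocalAbelianGroup

/-! ### Density of the regular points. -/

/-- Analytic vector fields on a domain that are not holomorphically linearly bound are pointwise
linearly independent on a dense set. -/
lemma NotHolLinearlyBound.subset_closure {𝕜 : Type*} [RCLike 𝕜] {n : ℕ} {ι : Type*} [Fintype ι]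
    {Ω : Set (Fin n → 𝕜)} (hΩ : IsOpen Ω) (hΩc : IsPreconnected Ω)
    {v : ι → (Fin n → 𝕜) → (Fin n → 𝕜)} (hv : ∀ i, AnalyticOnNhd 𝕜 (v i) Ω)
    (h : NotHolLinearlyBound Ω v) :
    Ω ⊆ closure {x | LinearIndependent 𝕜 (fun i => v i x)} := by
  classical
  intro p₀ hp₀
  rw [mem_closure_iff]
  intro V hV hpV
  by_contra hne
  have hdep : ∀ x ∈ V, ¬ LinearIndependent 𝕜 (fun i => v i x) := fun x hx hi => hne ⟨x, hx, hi⟩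
  set P : ℕ → Prop := fun r => ∃ c : Fin r → ι, ∃ x ∈ V ∩ Ω, LinearIndependent 𝕜 fun s => v (c s) x
    with hP
  have hcinj : ∀ {r : ℕ} {c : Fin r → ι} {x}, LinearIndependent 𝕜 (fun s => v (c s) x) →
      Function.Injective c := fun hi s t hst => hi.injective (by simp [hst])
  have hP0 : P 0 := ⟨Fin.elim0, p₀, ⟨hpV, hp₀⟩, linearIndependent_empty_type⟩
  have hPb : ∀ r, P r → r ≤ Fintype.card ι := by
    rintro r ⟨c, x, -, hi⟩
    simpa using Fintype.card_le_of_injective c (hcinj hi)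
  -- `r` is the largest rank attained on `V ∩ Ω`, `p` a point where it is attained by the subfamily
  -- `c`, and `l` an index outside it.
  set r := Nat.findGreatest P (Fintype.card ι) with hr
  obtain ⟨c, p, hp, hi⟩ : P r := Nat.findGreatest_spec (Nat.zero_le _) hP0
  have hmax : ¬ P (r + 1) := fun hs =>
    absurd (Nat.le_findGreatest (hPb _ hs) hs) (by omega)
  obtain ⟨l, hl⟩ : ∃ l, ∀ s, c s ≠ l := by
    by_contra hcon
    push Not at hcon
    exact hdep p hp.1 ((linearIndependent_equiv (Equiv.ofBijective c ⟨hcinj hi, hcon⟩)).mp hi)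
  -- `L` reads off coordinates with respect to the subfamily at `p`; it turns the `n × r` family
  -- into a square matrix `M` with `M p = 1`.
  obtain ⟨L, hL⟩ := LinearMap.exists_leftInverse_of_injective
    (Fintype.linearCombination 𝕜 (fun s => v (c s) p)) (by
      rw [LinearMap.ker_eq_bot']
      intro e he
      exact funext (Fintype.linearIndependent_iff.mp hi e (by
        simpa [Fintype.linearCombination_apply] using he)))
  set M : (Fin n → 𝕜) → Matrix (Fin r) (Fin r) 𝕜 := fun x => Matrix.of fun i j => L (v (c j) x) i
    with hM
  have hLa : ∀ i, AnalyticOnNhd 𝕜 (fun x => L (v i x)) Ω := fun i x hx =>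
    AnalyticAt.fun_comp ((LinearMap.toContinuousLinearMap L).analyticAt _) (hv i x hx)
  have hMa : ∀ x ∈ Ω, ∀ i j, AnalyticAt 𝕜 (fun y => M y i j) x :=
    fun x hx i j => (hLa (c j) x hx).pi_apply i
  have hMmul : ∀ x e, (M x).mulVec e = L (∑ s, e s • v (c s) x) := by
    intro x e
    funext i
    simp [Matrix.mulVec, dotProduct, hM, mul_comm]
  have hMp : M p = 1 := by
    ext i j
    have h1 := congrFun (LinearMap.congr_fun hL (Pi.single j 1)) i
    simpa [hM, Matrix.one_apply, Pi.single_apply] using h1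
  set cr : Fin r → (Fin n → 𝕜) → 𝕜 := fun s x => (M x).cramer (L (v l x)) s with hcr
  have hcra : ∀ s, AnalyticOnNhd 𝕜 (cr s) Ω := fun s x hx =>
    AnalyticAt.matrix_cramer (hMa x hx) (fun i => (hLa l x hx).pi_apply i) s
  have hdeta : AnalyticOnNhd 𝕜 (fun x => (M x).det) Ω := fun x hx =>
    AnalyticAt.matrix_det (hMa x hx)
  -- Cramer's rule without division, so that `w` is analytic on all of `Ω` and `L (w x) = 0`. Near
  -- `p` maximality of `r` puts `w x` in the span of the subfamily, where `L` is injective; hence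
  -- `w` vanishes there, and then on `Ω`.
  set w : (Fin n → 𝕜) → (Fin n → 𝕜) := fun x => (M x).det • v l x - ∑ s, cr s x • v (c s) x with hw
  have hwa : AnalyticOnNhd 𝕜 w Ω := fun x hx =>
    ((hdeta x hx).smul (hv l x hx)).sub
      (Finset.analyticAt_fun_sum _ fun s _ => (hcra s x hx).smul (hv (c s) x hx))
  have hLw : ∀ x, L (w x) = 0 := by
    intro x
    rw [hw, map_sub, map_smul, ← hMmul x (fun s => cr s x)]
    exact sub_eq_zero.mpr (Matrix.mulVec_cramer (M x) (L (v l x))).symm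
  have hnear : w =ᶠ[𝓝 p] 0 := by
    have h1 : ∀ᶠ x in 𝓝 p, (M x).det ≠ 0 :=
      (hdeta p hp.2).continuousAt.eventually_ne (by simp [hMp])
    filter_upwards [h1, (hV.inter hΩ).mem_nhds hp] with x hx hxV
    have hxi : LinearIndependent 𝕜 fun s => v (c s) x := by
      rw [Fintype.linearIndependent_iff]
      intro e he s
      refine congrFun (Matrix.eq_zero_of_mulVec_eq_zero hx (v := e) ?_) s
      rw [hMmul, he, map_zero]
    have hspan : v l x ∈ Submodule.span 𝕜 (Set.range fun s => v (c s) x) := by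
      by_contra hns
      refine hmax ⟨Fin.cons l c, x, hxV, ?_⟩
      have h2 := linearIndependent_finCons.mpr ⟨hxi, hns⟩
      have h3 : (fun s => v ((Fin.cons l c : Fin (r + 1) → ι) s) x) =
          Fin.cons (v l x) fun s => v (c s) x := by
        funext s
        refine Fin.cases ?_ (fun s => ?_) s <;> simp
      rw [h3]
      exact h2
    obtain ⟨d, hd⟩ := (Submodule.mem_span_range_iff_exists_fun 𝕜).mp hspan
    have hwe : w x = ∑ s, ((M x).det * d s - cr s x) • v (c s) x := by
      simp only [hw, ← hd, sub_smul, Finset.sum_sub_distrib, Finset.smul_sum, smul_smul]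
    have he : (fun s => (M x).det * d s - cr s x) = 0 := by
      refine Matrix.eq_zero_of_mulVec_eq_zero hx ?_
      rw [hMmul, ← hwe, hLw]
    rw [hwe]
    refine Finset.sum_eq_zero fun s _ => ?_
    have := congrFun he s
    simp only [Pi.zero_apply] at this
    rw [this, zero_smul]
  have hw0 := hwa.eqOn_zero_of_preconnected_of_eventuallyEq_zero hΩc hp.2 hnear
  -- The coefficients of `w` in the whole family. The relation is nontrivial because `a l p = det (M
  -- p) = 1`.
  set a : ι → (Fin n → 𝕜) → 𝕜 := fun i x =>
    (if i = l then (M x).det else 0) - ∑ s, if c s = i then cr s x else 0 with ha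
  have haa : ∀ i, AnalyticOnNhd 𝕜 (a i) Ω := by
    intro i x hx
    refine AnalyticAt.sub ?_ (Finset.analyticAt_fun_sum _ fun s _ => ?_)
    · split_ifs
      exacts [hdeta x hx, analyticAt_const]
    · split_ifs
      exacts [hcra s x hx, analyticAt_const]
  have hsum : ∀ x ∈ Ω, ∑ i, a i x • v i x = 0 := by
    intro x hx
    refine Eq.trans ?_ (hw0 hx)
    simp only [ha, hw, sub_smul, Finset.sum_sub_distrib, ite_smul, zero_smul, Finset.sum_ite_eq',
      Finset.mem_univ, if_true, Finset.sum_smul]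
    rw [Finset.sum_comm]
    simp
  have hal := h a haa hsum l p hp.2
  simp [ha, hl, hMp] at hal

/-- A functional that vanishes on the range of `A` is a linear relation between its coordinates, so
the dual map is injective. -/
lemma surjective_of_linearIndependent_coord {𝕜 V : Type*} [Field 𝕜] [AddCommGroup V] [Module 𝕜 V]
    {r : ℕ} {A : V →ₗ[𝕜] (Fin r → 𝕜)}
    (h : LinearIndependent 𝕜 (fun τ => (LinearMap.proj τ : (Fin r → 𝕜) →ₗ[𝕜] 𝕜) ∘ₗ A)) :
    Function.Surjective A := by
  rw [← LinearMap.dualMap_injective_iff, injective_iff_map_eq_zero]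
  intro ψ hψ
  have h1 : ψ = ∑ τ, ψ (Pi.single τ 1) • (LinearMap.proj τ : (Fin r → 𝕜) →ₗ[𝕜] 𝕜) := by
    refine LinearMap.pi_ext' fun τ => LinearMap.ext_ring ?_
    simp [Pi.single_apply]
  have h2 : ∑ τ, ψ (Pi.single τ 1) • ((LinearMap.proj τ : (Fin r → 𝕜) →ₗ[𝕜] 𝕜) ∘ₗ A) = 0 := by
    ext x
    have h3 := LinearMap.congr_fun hψ x
    rw [h1] at h3
    simpa using h3
  have h4 := Fintype.linearIndependent_iff.mp h _ h2
  rw [h1]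
  simp [h4]

namespace LocalAbelianGroup

variable {𝕜 : Type*} [RCLike 𝕜] {q n : ℕ} {Ω : Set (Fin n → 𝕜)} {G : LocalAbelianGroup 𝕜 q n Ω}
  {I : (Fin n → 𝕜) → (Fin (n - q) → 𝕜)}

lemma eventually_linearIndependent_fderiv {r : ℕ} {J : (Fin n → 𝕜) → (Fin r → 𝕜)} {p : Fin n → 𝕜}
    (hJ : AnalyticAt 𝕜 J p) (hp : LinearIndependent 𝕜 (fun τ => fderiv 𝕜 (fun y => J y τ) p)) :
    ∀ᶠ x in 𝓝 p, LinearIndependent 𝕜 (fun τ => fderiv 𝕜 (fun y => J y τ) x) := by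
  have hc : ContinuousAt (fun x => fun τ => fderiv 𝕜 (fun y => J y τ) x) p :=
    continuousAt_pi.mpr fun τ => (hJ.pi_apply τ).fderiv.continuousAt
  exact hc.eventually hp.eventually

lemma IndependentInvariants.mono {U V : Set (Fin n → 𝕜)} (hI : G.IndependentInvariants V I)
    (hU : IsOpen U) (hUV : U ⊆ V) : G.IndependentInvariants U I := by
  refine ⟨hI.1.mono hUV, fun τ => (hI.2.1 τ).mono hUV, fun x hx => ?_⟩
  have h1 := hU.inter_closure ⟨hx, hI.2.2 (hUV hx)⟩
  refine closure_mono ?_ h1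
  rintro y ⟨hy, -, hi⟩
  exact ⟨hy, hi⟩

/-- The points at which operators and invariants are independent are dense. -/
lemma subset_closure_independent (hΩc : IsPreconnected Ω)
    (hgind : NotHolLinearlyBound Ω G.infOp) (hI : G.IndependentInvariants Ω I) :
    Ω ⊆ closure {p ∈ Ω | LinearIndependent 𝕜 (fun l => G.infOp l p) ∧
        LinearIndependent 𝕜 (fun τ => fderiv 𝕜 (fun y => I y τ) p)} := by
  intro p hp
  rw [mem_closure_iff]
  intro V hV hpV
  obtain ⟨x, hxV, hxΩ, hx⟩ := mem_closure_iff.mp (hI.2.2 hp) V hV hpV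
  -- Independence of the differentials is an open condition, so a second, merely dense condition can
  -- be met without losing it.
  obtain ⟨N, hN, hNo, hxN⟩ := eventually_nhds_iff.mp
    (eventually_linearIndependent_fderiv (hI.1 x hxΩ) hx)
  have hΩ := G.isOpen_base
  obtain ⟨y, ⟨⟨hyN, hyV⟩, hyΩ⟩, hy⟩ := mem_closure_iff.mp
    (hgind.subset_closure hΩ hΩc (G.analyticOnNhd_infOp) hxΩ) ((N ∩ V) ∩ Ω)
    ((hNo.inter hV).inter hΩ) ⟨⟨hxN, hxV⟩, hxΩ⟩
  exact ⟨y, hyV, hyΩ, hy, hN y hyN⟩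

end LocalAbelianGroup

/-! ### Analytic charts and translation groups in them. -/

section Chart

variable {𝕜 : Type*} [RCLike 𝕜] {E F : Type*} [NormedAddCommGroup E] [NormedSpace 𝕜 E]
  [NormedAddCommGroup F] [NormedSpace 𝕜 F]

/-- The analytic inverse function theorem, with a chart whose derivative is invertible
everywhere. -/
lemma AnalyticAt.exists_openPartialHomeomorph [CompleteSpace E] [CompleteSpace F] {f : E → F} {a : E}
    (hf : AnalyticAt 𝕜 f a) {f' : E ≃L[𝕜] F} (hf' : HasFDerivAt f (f' : E →L[𝕜] F) a) :
    ∃ e : OpenPartialHomeomorph E F, ⇑e = f ∧ a ∈ e.source ∧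
      (∀ x ∈ e.source, AnalyticAt 𝕜 f x ∧ ∃ i : E ≃L[𝕜] F, fderiv 𝕜 f x = i) ∧
      ∀ y ∈ e.target, AnalyticAt 𝕜 e.symm y := by
  have hn : (⊤ : WithTop ℕ∞) ≠ 0 := by simp
  set e₀ := (hf.contDiffAt (n := ⊤)).toOpenPartialHomeomorph f hf' hn with he₀
  have h1 : ∀ᶠ x in 𝓝 a, AnalyticAt 𝕜 f x ∧ ∃ i : E ≃L[𝕜] F, fderiv 𝕜 f x = i := by
    refine hf.eventually_analyticAt.and ?_
    have h2 : fderiv 𝕜 f a ∈ Set.range ((↑) : (E ≃L[𝕜] F) → E →L[𝕜] F) := ⟨f', hf'.fderiv.symm⟩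
    filter_upwards [hf.fderiv.continuousAt.eventually
      (ContinuousLinearEquiv.isOpen.mem_nhds h2)] with x hx
    obtain ⟨i, hi⟩ := hx
    exact ⟨i, hi.symm⟩
  -- Restricting the source to points with invertible derivative makes the inverse analytic on the
  -- whole target, not only at `f a`.
  obtain ⟨O, hO, hOo, haO⟩ := eventually_nhds_iff.mp h1
  refine ⟨e₀.restrOpen O hOo, rfl, ⟨(hf.contDiffAt (n := ⊤)).mem_toOpenPartialHomeomorph_source
    hf' hn, haO⟩, fun x hx => hO x hx.2, fun y hy => ?_⟩
  have hs := (e₀.restrOpen O hOo).map_target hy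
  obtain ⟨h2, i, hi⟩ := hO _ hs.2
  exact (e₀.restrOpen O hOo).analyticAt_symm hy h2 hi

variable {e : OpenPartialHomeomorph E F}

lemma fderiv_symm_apply_fderiv {z : E} (hz : z ∈ e.source) (he : AnalyticAt 𝕜 e z)
    (hs : AnalyticAt 𝕜 e.symm (e z)) (v : E) :
    fderiv 𝕜 e.symm (e z) (fderiv 𝕜 e z v) = v := by
  have h1 := HasFDerivAt.comp z hs.differentiableAt.hasFDerivAt he.differentiableAt.hasFDerivAt
  have h2 : e.symm ∘ e =ᶠ[𝓝 z] id := by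
    filter_upwards [e.open_source.mem_nhds hz] with y hy using e.left_inv hy
  have h3 := h1.unique ((hasFDerivAt_id z).congr_of_eventuallyEq h2)
  simpa using congrArg (fun L => L v) h3

/-- The fields that are constant in an analytic chart commute. -/
lemma lieBracket_fderiv_chart [CompleteSpace F] {z : E} (hz : z ∈ e.source)
    (he : AnalyticAt 𝕜 e z) (hs : AnalyticAt 𝕜 e.symm (e z)) (v w : E) :
    VectorField.lieBracket 𝕜 (fun y => fderiv 𝕜 e (e.symm y) v)
      (fun y => fderiv 𝕜 e (e.symm y) w) (e z) = 0 := by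
  -- Each half of the bracket is a second derivative of the chart, and second derivatives are
  -- symmetric.
  have key : ∀ v w : E, fderiv 𝕜 (fun y => fderiv 𝕜 e (e.symm y) w) (e z)
      (fderiv 𝕜 e z v) = fderiv 𝕜 (fderiv 𝕜 e) z v w := by
    intro v w
    have h1 : HasFDerivAt (fun y => fderiv 𝕜 e (e.symm y))
        ((fderiv 𝕜 (fderiv 𝕜 e) z).comp (fderiv 𝕜 e.symm (e z))) (e z) := by
      refine HasFDerivAt.comp (e z) ?_ hs.differentiableAt.hasFDerivAt
      rw [e.left_inv hz]
      exact he.fderiv.differentiableAt.hasFDerivAt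
    have h2 := h1.clm_apply (hasFDerivAt_const w (e z))
    rw [h2.fderiv]
    simp [fderiv_symm_apply_fderiv hz he hs]
  have hsymm : IsSymmSndFDerivAt 𝕜 e z := he.contDiffAt.isSymmSndFDerivAt (n := ⊤) le_top
  rw [VectorField.lieBracket_eq]
  simp only [e.left_inv hz]
  rw [key, key, hsymm.eq, sub_self]

end Chart

section Translation

variable {𝕜 : Type*} [RCLike 𝕜] {E : Type*} [NormedAddCommGroup E] [NormedSpace 𝕜 E]
  {r n : ℕ} (e : OpenPartialHomeomorph E (Fin n → 𝕜)) (B : Set E)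

/-- The group of translations along a subspace in an analytic chart. -/
noncomputable def translationGroup (ι : (Fin r → 𝕜) →L[𝕜] E) (hB : IsOpen B) (hBs : B ⊆ e.source)
    (he : ∀ z ∈ e.source, AnalyticAt 𝕜 e z) (hs : ∀ y ∈ e.target, AnalyticAt 𝕜 e.symm y) :
    LocalAbelianGroup 𝕜 r n (e '' B) where
  dom := {p | p.2 ∈ e '' B ∧ e.symm p.2 + ι p.1 ∈ B}
  act β x := e (e.symm x + ι β)
  isOpen_dom := by
    have hU : IsOpen (e '' B) := e.isOpen_image_of_subset_source hB hBs
    have hc : ContinuousOn (fun p : (Fin r → 𝕜) × (Fin n → 𝕜) => e.symm p.2 + ι p.1)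
        (Prod.snd ⁻¹' (e '' B)) := by
      refine ContinuousOn.add ?_ (by fun_prop)
      refine e.symm.continuousOn.comp continuousOn_snd ?_
      rintro p ⟨z, hz, hzp⟩
      rw [← hzp]
      exact e.map_source (hBs hz)
    exact hc.isOpen_inter_preimage (hU.preimage continuous_snd) hB
  snd_mem _ _ h := h.1
  zero_mem := by
    rintro _ ⟨z, hz, rfl⟩
    exact ⟨⟨z, hz, rfl⟩, by simpa [e.left_inv (hBs hz)] using hz⟩
  act_mem _ _ h := ⟨_, h.2, rfl⟩
  analytic_act := by
    rintro ⟨β, x⟩ ⟨hx, hβ⟩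
    have hxt : x ∈ e.target := by
      obtain ⟨z, hz, rfl⟩ := hx
      exact e.map_source (hBs hz)
    have h1 : AnalyticAt 𝕜 (fun p : (Fin r → 𝕜) × (Fin n → 𝕜) => e.symm p.2 + ι p.1) (β, x) :=
      ((hs x hxt).fun_comp_of_eq analyticAt_snd rfl).add
        ((ι.analyticAt β).fun_comp_of_eq analyticAt_fst rfl)
    exact (he _ (hBs hβ)).fun_comp_of_eq h1 rfl
  act_zero := by
    rintro _ ⟨z, hz, rfl⟩
    simp [e.left_inv (hBs hz)]
  act_add := by
    rintro α β x ⟨-, hβ⟩ - -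
    simp only [] at hβ ⊢
    rw [e.left_inv (hBs hβ), map_add, add_assoc, add_comm (ι β)]
  neg_mem := by
    rintro β x ⟨⟨z, hz, rfl⟩, hβ⟩
    refine ⟨⟨_, hβ, rfl⟩, ?_⟩
    simp only [] at hβ ⊢
    rw [e.left_inv (hBs hβ), map_neg, add_neg_cancel_right, e.left_inv (hBs hz)]
    exact hz

variable {e B}

/-- The generators are constant fields in the chart, the form to which `lieBracket_fderiv_chart`
applies. -/
lemma translationGroup_gen {ι : (Fin r → 𝕜) →L[𝕜] E} {hB : IsOpen B} {hBs : B ⊆ e.source}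
    {he : ∀ z ∈ e.source, AnalyticAt 𝕜 e z} {hs : ∀ y ∈ e.target, AnalyticAt 𝕜 e.symm y}
    {x : Fin n → 𝕜} (hx : x ∈ e '' B) (b : Fin r → 𝕜) :
    (translationGroup e B ι hB hBs he hs).gen x b = fderiv 𝕜 e (e.symm x) (ι b) := by
  have hxs : e.symm x ∈ e.source := by
    obtain ⟨z, hz, rfl⟩ := hx
    rw [e.left_inv (hBs hz)]
    exact hBs hz
  have h1 : HasFDerivAt (fun β => e.symm x + ι β) ι 0 := ι.hasFDerivAt.const_add _
  have h2 : HasFDerivAt (fun β => e (e.symm x + ι β)) ((fderiv 𝕜 e (e.symm x)).comp ι) 0 := by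
    refine HasFDerivAt.comp (g := e) 0 ?_ h1
    simpa using (he _ hxs).differentiableAt.hasFDerivAt
  have h3 : (translationGroup e B ι hB hBs he hs).gen x = (fderiv 𝕜 e (e.symm x)).comp ι :=
    h2.fderiv
  rw [h3]
  rfl

end Translation

lemma notHolLinearlyBound_of_linearIndependent {𝕜 : Type*} [RCLike 𝕜] {n : ℕ} {ι : Type*}
    [Fintype ι] {U : Set (Fin n → 𝕜)} {v : ι → (Fin n → 𝕜) → (Fin n → 𝕜)}
    (h : ∀ x ∈ U, LinearIndependent 𝕜 (fun i => v i x)) : NotHolLinearlyBound U v :=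
  fun a _ hs i x hx => Fintype.linearIndependent_iff.mp (h x hx) (fun i => a i x) (hs x hx) i

/-! ### Straightening the group and its invariants near a regular point. -/

namespace LocalAbelianGroup

variable {𝕜 : Type*} [RCLike 𝕜] {q n : ℕ} {Ω : Set (Fin n → 𝕜)} {G : LocalAbelianGroup 𝕜 q n Ω}
  {I : (Fin n → 𝕜) → (Fin (n - q) → 𝕜)} {p : Fin n → 𝕜}

lemma surjective_fderiv {r : ℕ} {J : (Fin n → 𝕜) → (Fin r → 𝕜)} (hJ : AnalyticAt 𝕜 J p)
    (hp : LinearIndependent 𝕜 (fun τ => fderiv 𝕜 (fun y => J y τ) p)) :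
    Function.Surjective (fderiv 𝕜 J p) := by
  refine surjective_of_linearIndependent_coord (A := (fderiv 𝕜 J p : (Fin n → 𝕜) →ₗ[𝕜] (Fin r → 𝕜))) ?_
  have h1 : (fun τ => (LinearMap.proj τ : (Fin r → 𝕜) →ₗ[𝕜] 𝕜) ∘ₗ
      (fderiv 𝕜 J p : (Fin n → 𝕜) →ₗ[𝕜] (Fin r → 𝕜))) =
      fun τ => ContinuousLinearMap.coeLM 𝕜 (fderiv 𝕜 (fun y => J y τ) p) := by
    funext τ
    have h2 := hasFDerivAt_pi'.mp hJ.differentiableAt.hasFDerivAt τ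
    rw [h2.fderiv]
    rfl
  rw [h1]
  exact hp.map' _ (LinearMap.ker_eq_bot.mpr ContinuousLinearMap.coe_injective)

/-- The differentials of invariants vanish on the infinitesimal operators. -/
lemma fderiv_gen_eq_zero {r : ℕ} {J : (Fin n → 𝕜) → (Fin r → 𝕜)} (hJ : AnalyticAt 𝕜 J p)
    (hinv : ∀ τ, G.IsInvariant Ω (fun x => J x τ)) (hp : p ∈ Ω) (a : Fin q → 𝕜) :
    fderiv 𝕜 J p (G.gen p a) = 0 := by
  have h1 : HasFDerivAt (fun β => J (G.act β p)) ((fderiv 𝕜 J p).comp (G.gen p)) 0 := by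
    refine HasFDerivAt.comp 0 ?_ (G.hasFDerivAt_gen hp)
    rw [G.act_zero p hp]
    exact hJ.differentiableAt.hasFDerivAt
  -- A ball is star-shaped about `0`, so the whole arc `s • β` stays in the domain and invariance
  -- applies.
  obtain ⟨ε, hε, hball⟩ := Metric.eventually_nhds_iff_ball.mp (G.eventually_zero_mem hp)
  have h2 : (fun β => J (G.act β p)) =ᶠ[𝓝 0] fun _ => J p := by
    filter_upwards [Metric.ball_mem_nhds 0 hε] with β hβ
    refine funext fun τ => hinv τ β p hp fun s h0 h1 => ?_
    have hs : ((s : 𝕜) • β, p) ∈ G.dom := by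
      refine hball _ ?_
      rw [mem_ball_zero_iff] at hβ ⊢
      rw [norm_smul, RCLike.norm_ofReal, abs_of_nonneg h0]
      exact (mul_le_of_le_one_left (norm_nonneg _) h1).trans_lt hβ
    exact ⟨hs, G.act_mem _ _ hs⟩
  have h3 := h1.unique ((hasFDerivAt_const (J p) 0).congr_of_eventuallyEq h2)
  simpa using congrArg (fun L => L a) h3

/-- An analytic submersion has an analytic local section through every point. -/
lemma exists_section {r : ℕ} {J : (Fin n → 𝕜) → (Fin r → 𝕜)} (hJ : AnalyticAt 𝕜 J p)
    (hsurj : Function.Surjective (fderiv 𝕜 J p)) :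
    ∃ σ : (Fin r → 𝕜) → (Fin n → 𝕜), AnalyticAt 𝕜 σ (J p) ∧ σ (J p) = p ∧
      ∀ᶠ c in 𝓝 (J p), J (σ c) = c := by
  -- On the affine slice `p + N y` along a right inverse of `dJ` the map `J` has derivative the
  -- identity at `y = 0`, so it can be inverted there.
  obtain ⟨N₀, hN₀⟩ := (fderiv 𝕜 J p : (Fin n → 𝕜) →ₗ[𝕜] (Fin r → 𝕜)).exists_rightInverse_of_surjective
    (LinearMap.range_eq_top.mpr hsurj)
  set N := LinearMap.toContinuousLinearMap N₀ with hN
  have ht : AnalyticAt 𝕜 (fun y => p + N y) 0 := analyticAt_const.add (N.analyticAt 0)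
  have hp0 : p + N 0 = p := by simp
  have hJN : AnalyticAt 𝕜 (fun y => J (p + N y)) 0 := hJ.fun_comp_of_eq ht hp0
  have hd : HasFDerivAt (fun y => J (p + N y))
      ((ContinuousLinearEquiv.refl 𝕜 (Fin r → 𝕜) : (Fin r → 𝕜) →L[𝕜] (Fin r → 𝕜))) 0 := by
    have h1 : HasFDerivAt (fun y => p + N y) N 0 := N.hasFDerivAt.const_add _
    have h2 : HasFDerivAt (fun y => J (p + N y)) ((fderiv 𝕜 J p).comp N) 0 := by
      refine HasFDerivAt.comp (g := J) 0 ?_ h1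
      rw [hp0]
      exact hJ.differentiableAt.hasFDerivAt
    convert h2 using 1
    refine ContinuousLinearMap.coe_injective ?_
    exact hN₀.symm
  obtain ⟨e, he, h0, -, hes⟩ := hJN.exists_openPartialHomeomorph hd
  have he0 : e 0 = J p := by rw [he]; simp
  have hmem : J p ∈ e.target := he0 ▸ e.map_source h0
  have hsymm : e.symm (J p) = 0 := by rw [← he0, e.left_inv h0]
  refine ⟨fun c => p + N (e.symm c), ?_, by simp [hsymm], ?_⟩
  · exact ht.fun_comp_of_eq (hes _ hmem) hsymm
  · filter_upwards [e.open_target.mem_nhds hmem] with c hc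
    have := e.right_inv hc
    rw [he] at this
    exact this

/-- Near a point at which the operators and the invariants are independent there are coordinates
`(a, c)` in which the group acts by translations of `a` and the invariants are `c`. -/
lemma exists_straightening (hqn : q ≤ n) (hp : p ∈ Ω)
    (hg : LinearIndependent 𝕜 (fun l => G.infOp l p))
    {J : (Fin n → 𝕜) → (Fin (n - q) → 𝕜)} (hJ : AnalyticAt 𝕜 J p)
    (hinv : ∀ τ, G.IsInvariant Ω (fun x => J x τ))
    (hind : LinearIndependent 𝕜 (fun τ => fderiv 𝕜 (fun y => J y τ) p)) :
    ∃ (σ : (Fin (n - q) → 𝕜) → (Fin n → 𝕜))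
      (e : OpenPartialHomeomorph ((Fin q → 𝕜) × (Fin (n - q) → 𝕜)) (Fin n → 𝕜)),
      AnalyticAt 𝕜 σ (J p) ∧ σ (J p) = p ∧ (∀ᶠ c in 𝓝 (J p), J (σ c) = c) ∧
      (∀ z, e z = G.act z.1 (σ z.2)) ∧ ((0 : Fin q → 𝕜), J p) ∈ e.source ∧
      (∀ z ∈ e.source, AnalyticAt 𝕜 e z ∧ ∃ i : ((Fin q → 𝕜) × (Fin (n - q) → 𝕜)) ≃L[𝕜] (Fin n → 𝕜), fderiv 𝕜 e z = i) ∧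
      ∀ y ∈ e.target, AnalyticAt 𝕜 e.symm y := by
  obtain ⟨σ, hσ, hσp, hJσ⟩ := exists_section hJ (surjective_fderiv hJ hind)
  set S := fderiv 𝕜 σ (J p) with hS
  have hJS : ∀ b, fderiv 𝕜 J p (S b) = b := by
    intro b
    have h1 : HasFDerivAt (fun c => J (σ c)) ((fderiv 𝕜 J p).comp S) (J p) := by
      refine HasFDerivAt.comp (g := J) (J p) ?_ hσ.differentiableAt.hasFDerivAt
      rw [hσp]
      exact hJ.differentiableAt.hasFDerivAt
    have h2 := h1.unique ((hasFDerivAt_id (J p)).congr_of_eventuallyEq hJσ)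
    simpa using congrArg (fun L => L b) h2
  have hdom : ((0 : Fin q → 𝕜), σ (J p)) ∈ G.dom := by
    rw [hσp]
    exact G.zero_mem p hp
  have hpair : AnalyticAt 𝕜 (fun z : (Fin q → 𝕜) × (Fin (n - q) → 𝕜) => (z.1, σ z.2)) (0, J p) :=
    analyticAt_fst.prod (hσ.fun_comp_of_eq analyticAt_snd rfl)
  have hΨ : AnalyticAt 𝕜 (fun z : (Fin q → 𝕜) × (Fin (n - q) → 𝕜) => G.act z.1 (σ z.2))
      (0, J p) := (G.analyticAt_actPair hdom).fun_comp_of_eq hpair rfl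
  have hD : ∀ a b, fderiv 𝕜 (fun z : (Fin q → 𝕜) × (Fin (n - q) → 𝕜) => G.act z.1 (σ z.2))
      (0, J p) (a, b) = G.gen p a + S b := by
    intro a b
    set D := fderiv 𝕜 (fun z : (Fin q → 𝕜) × (Fin (n - q) → 𝕜) => G.act z.1 (σ z.2)) (0, J p)
      with hDdef
    have h1 : D.comp (ContinuousLinearMap.inl 𝕜 _ _) = G.gen p := by
      have h2 := HasFDerivAt.comp (f := fun a => (a, J p)) 0 hΨ.differentiableAt.hasFDerivAt
        (hasFDerivAt_prodMk_left 0 (J p))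
      have h3 : (fun z : (Fin q → 𝕜) × (Fin (n - q) → 𝕜) => G.act z.1 (σ z.2)) ∘
          (fun a => (a, J p)) = fun a => G.act a p := by
        funext a
        simp [hσp]
      rw [h3] at h2
      exact h2.unique (G.hasFDerivAt_gen hp)
    have h4 : D.comp (ContinuousLinearMap.inr 𝕜 _ _) = S := by
      have h2 := HasFDerivAt.comp (f := fun b => ((0 : Fin q → 𝕜), b)) (J p)
        hΨ.differentiableAt.hasFDerivAt (hasFDerivAt_prodMk_right 0 (J p))
      refine h2.unique (hσ.differentiableAt.hasFDerivAt.congr_of_eventuallyEq ?_)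
      have hΩ : ∀ᶠ c in 𝓝 (J p), σ c ∈ Ω :=
        hσ.continuousAt.eventually (G.isOpen_base.mem_nhds (by rw [hσp]; exact hp))
      filter_upwards [hΩ] with c hc using G.act_zero _ hc
    rw [← h1, ← h4]
    simp [← map_add]
  -- `dJ` kills the orbit directions and sends `S b` to `b`, so `b = 0`; independence of the
  -- operators then gives `a = 0`. With `q + (n - q) = n` injectivity suffices for an isomorphism.
  have hinj : Function.Injective
      (fderiv 𝕜 (fun z : (Fin q → 𝕜) × (Fin (n - q) → 𝕜) => G.act z.1 (σ z.2)) (0, J p)) := by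
    rw [injective_iff_map_eq_zero]
    rintro ⟨a, b⟩ hab
    rw [hD] at hab
    have hb : b = 0 := by
      have := congrArg (fderiv 𝕜 J p) hab
      simpa [fderiv_gen_eq_zero hJ hinv hp, hJS] using this
    rw [hb, map_zero, add_zero, G.gen_apply] at hab
    have ha : a = 0 := funext (Fintype.linearIndependent_iff.mp hg a hab)
    rw [ha, hb, Prod.mk_zero_zero]
  set i : ((Fin q → 𝕜) × (Fin (n - q) → 𝕜)) ≃L[𝕜] (Fin n → 𝕜) :=
    (LinearEquiv.ofInjectiveOfFinrankEq _ hinj (by simp; omega)).toContinuousLinearEquiv with hi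
  have hi' : HasFDerivAt (fun z : (Fin q → 𝕜) × (Fin (n - q) → 𝕜) => G.act z.1 (σ z.2))
      (i : _ →L[𝕜] (Fin n → 𝕜)) (0, J p) := by
    have hii : (i : _ →L[𝕜] (Fin n → 𝕜)) =
        fderiv 𝕜 (fun z : (Fin q → 𝕜) × (Fin (n - q) → 𝕜) => G.act z.1 (σ z.2)) (0, J p) :=
      ContinuousLinearMap.ext fun _ => rfl
    rw [hii]
    exact hΨ.differentiableAt.hasFDerivAt
  obtain ⟨e, he, h0, h1, h2⟩ := hΨ.exists_openPartialHomeomorph hi'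
  rw [← he] at h1
  exact ⟨σ, e, hσ, hσp, hJσ, fun z => by rw [he], h0, h1, h2⟩

end LocalAbelianGroup

namespace LocalAbelianGroup

variable {𝕜 : Type*} [RCLike 𝕜] {q n : ℕ} {Ω : Set (Fin n → 𝕜)} {G : LocalAbelianGroup 𝕜 q n Ω}
  {I : (Fin n → 𝕜) → (Fin (n - q) → 𝕜)} {p : Fin n → 𝕜}

/-- Near a point at which the operators and the invariants are independent, the invariants are a
basis and the operators have a commuting complement generated by an abelian group. -/
lemma exists_domain_isInvariantBasis (hqn : q ≤ n) (hI : G.IndependentInvariants Ω I) (hp : p ∈ Ω)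
    (hg : LinearIndependent 𝕜 (fun l => G.infOp l p))
    (hind : LinearIndependent 𝕜 (fun τ => fderiv 𝕜 (fun y => I y τ) p))
    {V : Set (Fin n → 𝕜)} (hV : V ∈ 𝓝 p) :
    ∃ U : Set (Fin n → 𝕜), IsOpen U ∧ IsConnected U ∧ p ∈ U ∧ U ⊆ V ∧ U ⊆ Ω ∧
      G.IsInvariantBasis U I ∧
      ∃ H : LocalAbelianGroup 𝕜 (n - q) n U, IsAbelianComplement U G.infOp H.infOp ∧
        ∀ x ∈ U, LinearIndependent 𝕜 (fun i => Sum.elim G.infOp H.infOp i x) := by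
  obtain ⟨σ, e, hσ, hσp, hIσ, heq, h0, he, hes⟩ :=
    exists_straightening hqn hp hg (hI.1 p hp) hI.2.1 hind
  have he0 : e (0, I p) = p := by rw [heq, hσp, G.act_zero p hp]
  have hpair : ContinuousAt (fun z : (Fin q → 𝕜) × (Fin (n - q) → 𝕜) => (z.1, σ z.2)) (0, I p) :=
    continuousAt_fst.prodMk (ContinuousAt.comp (g := σ) (f := Prod.snd)
      (x := ((0 : Fin q → 𝕜), I p)) hσ.continuousAt continuousAt_snd)
  have hdom : ∀ᶠ z : (Fin q → 𝕜) × (Fin (n - q) → 𝕜) in 𝓝 (0, I p), (z.1, σ z.2) ∈ G.dom :=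
    hpair.eventually (G.isOpen_dom.mem_nhds (by simpa [hσp] using G.zero_mem p hp))
  have hsnd : Filter.Tendsto (Prod.snd : (Fin q → 𝕜) × (Fin (n - q) → 𝕜) → _) (𝓝 (0, I p))
      (𝓝 (I p)) := continuousAt_snd
  have hVe : ∀ᶠ z in 𝓝 ((0 : Fin q → 𝕜), I p), e z ∈ V :=
    (he _ h0).1.continuousAt.eventually (by rw [he0]; exact hV)
  obtain ⟨r, hr, hball⟩ := Metric.eventually_nhds_iff_ball.mp
    ((e.open_source.eventually_mem h0).and (hdom.and (hVe.and
      ((hsnd.eventually hIσ).and (hsnd.eventually hσ.eventually_analyticAt)))))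
  set B := Metric.ball ((0 : Fin q → 𝕜), I p) r with hB
  have hBs : B ⊆ e.source := fun z hz => (hball z hz).1
  have hBd : ∀ z ∈ B, (z.1, σ z.2) ∈ G.dom := fun z hz => (hball z hz).2.1
  have hBI : ∀ z ∈ B, I (σ z.2) = z.2 := fun z hz => (hball z hz).2.2.2.1
  have hBσ : ∀ z ∈ B, AnalyticAt 𝕜 σ z.2 := fun z hz => (hball z hz).2.2.2.2
  have hBo : IsOpen B := Metric.isOpen_ball
  -- In the sup metric `B` is a product of balls, so the arc from `σ c` to `Φ_a (σ c)` stays in `e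
  -- '' B`. This is what lets invariance on `e '' B` be used.
  have hBscale : ∀ z ∈ B, ∀ s : ℝ, 0 ≤ s → s ≤ 1 → ((s : 𝕜) • z.1, z.2) ∈ B := by
    intro z hz s hs0 hs1
    rw [hB, ← ball_prod_same] at hz ⊢
    refine ⟨?_, hz.2⟩
    have h1 := hz.1
    rw [mem_ball_zero_iff] at h1 ⊢
    rw [norm_smul, RCLike.norm_ofReal, abs_of_nonneg hs0]
    exact (mul_le_of_le_one_left (norm_nonneg _) hs1).trans_lt h1
  have hUo : IsOpen (e '' B) := e.isOpen_image_of_subset_source hBo hBs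
  have hUΩ : e '' B ⊆ Ω := by
    rintro _ ⟨z, hz, rfl⟩
    rw [heq]
    exact G.act_mem _ _ (hBd z hz)
  have hUc : IsConnected (e '' B) := by
    refine IsConnected.image ?_ e (e.continuousOn.mono hBs)
    exact ⟨⟨_, Metric.mem_ball_self hr⟩, (convex_ball _ _).isPreconnected⟩
  have hσΩ : ∀ z ∈ B, σ z.2 ∈ Ω := fun z hz => G.snd_mem _ _ (hBd z hz)
  have hσe : ∀ z ∈ B, σ z.2 ∈ e '' B := by
    intro z hz
    have h1 := hBscale z hz 0 le_rfl zero_le_one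
    refine ⟨_, h1, ?_⟩
    rw [heq]
    simpa using G.act_zero _ (hσΩ z hz)
  have hmoves : ∀ z ∈ B, G.MovesIn (e '' B) z.1 (σ z.2) := by
    intro z hz s hs0 hs1
    have h1 := hBscale z hz s hs0 hs1
    exact ⟨hBd _ h1, _, h1, heq _⟩
  have hinv : ∀ u : (Fin n → 𝕜) → 𝕜, G.IsInvariant (e '' B) u → ∀ z ∈ B, u (e z) = u (σ z.2) := by
    intro u hu z hz
    rw [heq]
    exact hu _ _ (hσe z hz) (hmoves z hz)
  have hIU := hI.mono hUo hUΩ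
  have hIe : ∀ z ∈ B, I (e z) = z.2 := by
    intro z hz
    rw [← hBI z hz]
    exact funext fun τ => hinv _ (hIU.2.1 τ) z hz
  have hbasis : G.IsInvariantBasis (e '' B) I := by
    refine ⟨hIU, fun u hu hui => ⟨fun c => u (σ c), ?_, ?_⟩⟩
    · rintro _ ⟨_, ⟨z, hz, rfl⟩, rfl⟩
      rw [hIe z hz]
      exact (hu _ (hσe z hz)).fun_comp_of_eq (hBσ z hz) rfl
    · rintro _ ⟨z, hz, rfl⟩
      rw [hIe z hz]
      exact hinv u hui z hz
  -- The complementary group translates the coordinate `c`, that is, the values of the invariants.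
  set H := translationGroup e B (ContinuousLinearMap.inr 𝕜 (Fin q → 𝕜) (Fin (n - q) → 𝕜)) hBo hBs
    (fun z hz => (he z hz).1) hes with hH
  have hHgen : ∀ x ∈ e '' B, ∀ b, H.gen x b = fderiv 𝕜 e (e.symm x) (0, b) :=
    fun x hx b => translationGroup_gen hx b
  have hGgen : ∀ x ∈ e '' B, ∀ a, G.gen x a = fderiv 𝕜 e (e.symm x) (a, 0) := by
    rintro _ ⟨z, hz, rfl⟩ a
    rw [e.left_inv (hBs hz)]
    have h1 := HasFDerivAt.comp (f := fun a => (a, z.2)) z.1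
      ((he z (hBs hz)).1.differentiableAt.hasFDerivAt) (hasFDerivAt_prodMk_left z.1 z.2)
    have h2 : (e ∘ fun a => (a, z.2)) = fun a => G.act a (σ z.2) := funext fun a => heq _
    rw [h2] at h1
    have h3 := congrArg (fun L => L a) (h1.unique (G.hasFDerivAt_act_left (hBd z hz)))
    rw [heq, ← G.fderiv_actPair_left (hBd z hz)]
    simpa using h3.symm
  have hframe : ∀ x ∈ e '' B,
      LinearIndependent 𝕜 (fun i => Sum.elim G.infOp H.infOp i x) := by
    intro x hx
    rw [Fintype.linearIndependent_iff]
    intro c hc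
    simp only [Fintype.sum_sum_type, Sum.elim_inl, Sum.elim_inr] at hc
    have h1 : G.gen x (fun l => c (.inl l)) + H.gen x (fun τ => c (.inr τ)) = 0 := by
      rw [G.gen_apply, H.gen_apply]
      exact hc
    have hxs : e.symm x ∈ e.source := by
      obtain ⟨z, hz, rfl⟩ := hx
      rw [e.left_inv (hBs hz)]
      exact hBs hz
    obtain ⟨-, i, hi⟩ := he _ hxs
    rw [hGgen x hx, hHgen x hx, ← map_add, hi] at h1
    have h2 := (map_eq_zero_iff i i.injective).mp h1
    rw [Prod.mk_add_mk, add_zero, zero_add, Prod.mk_eq_zero] at h2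
    rintro (l | τ)
    · exact congrFun h2.1 l
    · exact congrFun h2.2 τ
  -- The generators of `G` and of `H` are all constant in the chart, so a single computation gives
  -- every bracket.
  have hbr : ∀ (X Y : (Fin n → 𝕜) → (Fin n → 𝕜)) (v w : (Fin q → 𝕜) × (Fin (n - q) → 𝕜)),
      (∀ x ∈ e '' B, X x = fderiv 𝕜 e (e.symm x) v) →
      (∀ x ∈ e '' B, Y x = fderiv 𝕜 e (e.symm x) w) →
      ∀ x ∈ e '' B, VectorField.lieBracket 𝕜 X Y x = 0 := by
    intro X Y v w hX hY x hx
    have hX' : X =ᶠ[𝓝 x] fun y => fderiv 𝕜 e (e.symm y) v := by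
      filter_upwards [hUo.mem_nhds hx] with y hy using hX y hy
    have hY' : Y =ᶠ[𝓝 x] fun y => fderiv 𝕜 e (e.symm y) w := by
      filter_upwards [hUo.mem_nhds hx] with y hy using hY y hy
    rw [hX'.lieBracket_vectorField_eq hY']
    obtain ⟨z, hz, rfl⟩ := hx
    exact lieBracket_fderiv_chart (hBs hz) (he z (hBs hz)).1 (hes _ (e.map_source (hBs hz))) v w
  refine ⟨e '' B, hUo, hUc, ⟨_, Metric.mem_ball_self hr, he0⟩, ?_, hUΩ, hbasis, H,
    ⟨H.analyticOnNhd_infOp, fun τ σ => hbr _ _ _ _ (fun x hx => hHgen x hx _)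
      (fun x hx => hHgen x hx _), fun l τ => hbr _ _ _ _ (fun x hx => hGgen x hx _)
      (fun x hx => hHgen x hx _), notHolLinearlyBound_of_linearIndependent hframe⟩, hframe⟩
  rintro _ ⟨z, hz, rfl⟩
  exact (hball z hz).2.2.1

end LocalAbelianGroup

theorem theorem2 {𝕜 : Type*} [RCLike 𝕜] {n m q k : ℕ}
    (hq : 1 ≤ q) (hqn : q ≤ n) (hk : 1 ≤ k) (hkn : k ≤ n)
    -- the domain of the phase space
    (Ω : Set (Fin n → 𝕜)) (hΩ : IsOpen Ω) (hΩc : IsConnected Ω)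
    -- the abelian group and its `(n - k)`-cylindrical infinitesimal operators
    (G : LocalAbelianGroup 𝕜 q n Ω)
    (g : Fin q → (Fin k → 𝕜) → (Fin n → 𝕜))
    (hg : ∀ l, ∀ x ∈ Ω, G.infOp l x = g l (fun a : Fin k => x (Fin.castLE hkn a)))
    (hgind : NotHolLinearlyBound Ω G.infOp)
    -- its functionally independent absolute invariants
    (I : (Fin n → 𝕜) → (Fin (n - q) → 𝕜))
    (hI : G.IndependentInvariants Ω I) :
    -- the characterization, on every subdomain `U` of `Ω` (including `Ω` itself) and for every
    -- choice of the commuting operators `h` on `U`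
    (∀ U : Set (Fin n → 𝕜), IsOpen U → IsConnected U → U ⊆ Ω →
      ∀ h : Fin (n - q) → (Fin n → 𝕜) → (Fin n → 𝕜), IsAbelianComplement U G.infOp h →
      ∀ f : (Fin n → 𝕜) → Matrix (Fin n) (Fin m) 𝕜,
        (∀ i j, AnalyticOnNhd 𝕜 (fun x => f x i j) U) → CompletelySolvable f U →
        (HasInvariantForm U I (fun l x => g l (fun a : Fin k => x (Fin.castLE hkn a))) h f →
          G.AdmittedBy U f) ∧
        (G.IsInvariantBasis U I →
          (∀ x ∈ U, LinearIndependent 𝕜 (fun i => Sum.elim G.infOp h i x)) →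
          (G.AdmittedBy U f ↔
            HasInvariantForm U I (fun l x => g l (fun a : Fin k => x (Fin.castLE hkn a))) h f))) ∧
    -- the points at which operators and invariants are independent are dense in `Ω`
    (Ω ⊆ closure {p ∈ Ω | LinearIndependent 𝕜 (fun l => G.infOp l p) ∧
        LinearIndependent 𝕜 (fun τ => fderiv 𝕜 (fun y => I y τ) p)}) ∧
    -- and near each of them all the conditions above are met
    (∀ p ∈ Ω, LinearIndependent 𝕜 (fun l => G.infOp l p) →
      LinearIndependent 𝕜 (fun τ => fderiv 𝕜 (fun y => I y τ) p) →
      ∀ V ∈ 𝓝 p, ∃ U : Set (Fin n → 𝕜), IsOpen U ∧ IsConnected U ∧ p ∈ U ∧ U ⊆ V ∧ U ⊆ Ω ∧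
        G.IsInvariantBasis U I ∧
        ∃ H : LocalAbelianGroup 𝕜 (n - q) n U, IsAbelianComplement U G.infOp H.infOp ∧
          ∀ x ∈ U, LinearIndependent 𝕜 (fun i => Sum.elim G.infOp H.infOp i x)) := by

  refine ⟨fun U hU hUc hUΩ h hh f hf hs => ?_, G.subset_closure_independent hΩc.isPreconnected hgind hI,
    fun p hp hgp hIp V hV => G.exists_domain_isInvariantBasis hqn hI hp hgp hIp hV⟩
  have hgU : ∀ l, ∀ x ∈ U, G.infOp l x = g l (fun a : Fin k => x (Fin.castLE hkn a)) :=
    fun l x hx => hg l x (hUΩ hx)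
  have himp : HasInvariantForm U I (fun l x => g l (fun a : Fin k => x (Fin.castLE hkn a))) h f →
      G.AdmittedBy U f := fun hform =>
    LocalAbelianGroup.admittedBy_of_hasInvariantForm (fun τ => (hI.2.1 τ).mono hUΩ) hh
      (hform.congr fun l x hx => (hgU l x hx).symm)
  exact ⟨himp, fun hbasis hind => ⟨fun hadm =>
    (hadm.hasInvariantForm hqn hU hUc hUΩ hh hind hbasis hf hs).congr hgU, himp⟩⟩
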